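/- Let $K\subset\mathbb R^2$ be a compact convex set with support function $p(\varphi)=\max_{x\in K}\langle x,N(\varphi)\rangle$, $N(\varphi)=(\cos\varphi,\sin\varphi)$. Assume that $K$ is strictly convex with boundary $\Gamma$ of class $C^2$, in the sense that $p$ is of class $C^2$ and $p+p''>0$ everywhere, and that $K$ has constant width (its orthogonal projections on all directions have the same length). Let $F$ be the area of $K$, $L$ the length of $\Gamma$, and $\Delta=L^2-4\pi F$. Let $F_e$ be the area with multiplicities of the evolute of $\Gamma$, the closed curve with generalized support function $f(\theta)=p'(\theta-\pi/2)$, that is, $F_e=\frac12\int_0^{2\pi}(f^2-f'^2)\,d\theta$. For $P\notin K$ let $\omega=\omega(P)$ be the angle between the two tangents from $P$ to $\Gamma$. Then the integral below converges absolutely and $$\frac49\pi|F_e|-\Delta\ \ge\ \frac{64}{9}\int_{P\notin K}\Bigl(\omega-2\sin\omega+\sin2\omega-\tfrac14\sin4\omega-\sin^3\omega\Bigr)\,dP .$$ The right-hand side is strictly positive if $\frac49\pi|F_e|-\Delta\ne0$, and it is $0$ if $\frac49\pi|F_e|-\Delta=0$. Equality holds if and only if $K$ is a disk, or $K$ is bounded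 by a curve parallel to a Steiner curve (hypocycloid with three cusps), or $K$ is bounded by a curve parallel to a hypocycloid with five cusps, or $K$ is a Minkowski sum of finitely many domains of these types. Here a closed curve has the $2\pi$-periodic $C^2$ function $f$ as generalized support function if it is the envelope $f(\theta)N(\theta)+f'(\theta)N'(\theta)$ of the lines $x\cos\theta+y\sin\theta=f(\theta)$, and its parallel curves are those with generalized support functions $f+d$, $d\in\mathbb R$. A hypocycloid with $m$ cusps is a curve traced by a point of a circle of radius $r>0$ rolling inside a circle of radius $kr$, where $k=m/n>2$ in lowest terms (so $k=3$ for $m=3$; for $m=5$ the one with a $2\pi$-periodic generalized support function has $k=5/2$), in arbitrary position. The domains in the Minkowski sum are disks and domains bounded by curves parallel to hypocycloids with three or five cusps; they need not be convex, and Minkowski sum means that the support function of $K$ is the sum of their generalized support functions. -/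

import Mathlib

noncomputable section

namespace HurwitzWidth

open MeasureTheory

/-- The Euclidean plane. -/
abbrev Plane : Type := EuclideanSpace ℝ (Fin 2)

/-- The unit vector `N(φ) = (cos φ, sin φ)`. -/
def dirN (φ : ℝ) : Plane := !₂[Real.cos φ, Real.sin φ]

/-- Its derivative `N'(φ) = (-sin φ, cos φ)`. -/
def dirT (φ : ℝ) : Plane := !₂[-Real.sin φ, Real.cos φ]

/-- The support function `p(φ) = sup {⟨x, N(φ)⟩ : x ∈ K}` of a set `K`. -/
def supportFun (K : Set Plane) (φ : ℝ) : ℝ :=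
  sSup ((fun x : Plane => inner ℝ x (dirN φ)) '' K)

/-- The curve with generalized support function `f`: the envelope of the lines
`x cos θ + y sin θ = f(θ)`, parametrized by the angle `θ` of the normal. -/
def envelope (f : ℝ → ℝ) (θ : ℝ) : Plane := f θ • dirN θ + deriv f θ • dirT θ

/-- A compact convex set, strictly convex in the `C²` sense: the support function `p` is `C²`
and the radius of curvature `p + p''` of the boundary is everywhere positive. -/
structure IsStrictlyConvexC2 (K : Set Plane) : Prop where
  nonempty : K.Nonempty
  isCompact : IsCompact K
  convex : Convex ℝ K
  contDiff : ContDiff ℝ 2 (supportFun K)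
  radius_pos : ∀ φ, 0 < supportFun K φ + deriv (deriv (supportFun K)) φ

/-- Constant width: the orthogonal projections of `K` on all directions have the same length. -/
def HasConstantWidth (K : Set Plane) : Prop :=
  ∃ w : ℝ, ∀ φ : ℝ, volume.real ((fun x : Plane => inner ℝ x (dirN φ)) '' K) = w

/-- The length `L` of the boundary of `K`, which is parametrized by its normal angle as the
envelope of the support lines of `K`. -/
def boundaryLength (K : Set Plane) : ℝ :=
  ∫ φ in (0 : ℝ)..(2 * Real.pi), ‖deriv (envelope (supportFun K)) φ‖

/-- The isoperimetric deficit `Δ = L² - 4πF`, with `F` the area of `K`. -/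
def isoDeficit (K : Set Plane) : ℝ :=
  boundaryLength K ^ 2 - 4 * Real.pi * volume.real K

/-- The area with multiplicities (swept by the radius vector over one period) of the closed curve
with `2π`-periodic generalized support function `f`; see `signedArea_eq`. In this form it makes
sense for every `f` of class `C¹`. -/
def signedArea (f : ℝ → ℝ) : ℝ :=
  1 / 2 * ∫ θ in (0 : ℝ)..(2 * Real.pi), (f θ ^ 2 - deriv f θ ^ 2)

/-- The generalized support function of the evolute of the curve with support function `p`.
The evolute is the envelope of the normals `⟨x, N'(φ)⟩ = p'(φ)`, and `N'(φ) = N(φ + π/2)`;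
see `envelope_evoluteSupport`. -/
def evoluteSupport (p : ℝ → ℝ) (θ : ℝ) : ℝ := deriv p (θ - Real.pi / 2)

/-- The area with multiplicities `F_e` of the evolute of the boundary of `K`. -/
def evoluteArea (K : Set Plane) : ℝ := signedArea (evoluteSupport (supportFun K))

/-- The points at which a line through `P` touches `K`: the points of `K` lying on a
support line of `K` through `P`. -/
def tangencyPoints (K : Set Plane) (P : Plane) : Set Plane :=
  {x | x ∈ K ∧ ∃ u : Plane, u ≠ 0 ∧ inner ℝ u (x - P) = (0 : ℝ) ∧
    ∀ y ∈ K, inner ℝ u (y - P) ≤ (0 : ℝ)}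

/-- The visual angle `ω` of the boundary of `K` from `P`: the angle at `P` between the two tangents
from `P` (the supremum only selects the two distinct tangency points). -/
def visualAngle (K : Set Plane) (P : Plane) : ℝ :=
  sSup {a | ∃ x ∈ tangencyPoints K P, ∃ y ∈ tangencyPoints K P,
    a = EuclideanGeometry.angle x P y}

/-- The function `ω - 2 sin ω + sin 2ω - ¼ sin 4ω - sin³ ω`. -/
def angleIntegrand (ω : ℝ) : ℝ :=
  ω - 2 * Real.sin ω + Real.sin (2 * ω) - 1 / 4 * Real.sin (4 * ω) - Real.sin ω ^ 3

/-- The hypocycloid traced by a point of a circle of radius `r` rolling inside a circle of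
radius `k * r`. -/
def hypocycloid (r k t : ℝ) : Plane :=
  !₂[r * (k - 1) * Real.sin t - r * Real.sin ((k - 1) * t),
     r * (k - 1) * Real.cos t + r * Real.cos ((k - 1) * t)]

/-- Rotation of the plane by the angle `α`. -/
def rotate (α : ℝ) (v : Plane) : Plane :=
  !₂[Real.cos α * v 0 - Real.sin α * v 1, Real.sin α * v 0 + Real.cos α * v 1]

/-- `f` is a generalized support function (over one period `2π`) of a hypocycloid with `m` cusps,
that is, with ratio of radii `k = m / n > 2` in lowest terms, in arbitrary position and size.
While the parameter `t` of the hypocycloid runs, its normal turns at the rate `(k - 2) / 2`. -/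
def IsHypocycloidSupport (m : ℕ) (f : ℝ → ℝ) : Prop :=
  ContDiff ℝ 2 f ∧ Function.Periodic f (2 * Real.pi) ∧
    ∃ n : ℕ, 0 < n ∧ Nat.Coprime m n ∧ 2 * n < m ∧
      ∃ (r α : ℝ) (c : Plane), 0 < r ∧ ∀ t : ℝ,
        envelope f (α + ((m / n : ℝ) - 2) / 2 * t) = c + rotate α (hypocycloid r (m / n) t)

/-- `f` is a generalized support function of a curve parallel (at a signed distance `d`) to a
hypocycloid with `m` cusps. -/
def IsParallelToHypocycloid (m : ℕ) (f : ℝ → ℝ) : Prop :=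
  ∃ g : ℝ → ℝ, IsHypocycloidSupport m g ∧ ∃ d : ℝ, ∀ φ, f φ = g φ + d

/-- The sets `D` occurring as summands, given by their generalized support functions: disks, and
domains bounded by a curve parallel to a Steiner curve (three cusps) or to a hypocycloid with five
cusps. They need not be convex. -/
def IsSummand (f : ℝ → ℝ) : Prop :=
  (∃ (c : Plane) (R : ℝ), 0 < R ∧ f = supportFun (Metric.closedBall c R)) ∨
    IsParallelToHypocycloid 3 f ∨ IsParallelToHypocycloid 5 f

/-- `K` is the Minkowski sum of finitely many summands as above: since these need not be convex,
the Minkowski sum is the one given by addition of the generalized support functions. -/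
def IsMinkowskiSum (K : Set Plane) : Prop :=
  ∃ (n : ℕ) (f : Fin (n + 1) → ℝ → ℝ), (∀ i, IsSummand (f i)) ∧
    ∀ φ, supportFun K φ = ∑ i, f i φ

/-- The left-hand side `(4/9) π |F_e| - Δ`. -/
def widthDeficit (K : Set Plane) : ℝ :=
  4 / 9 * Real.pi * |evoluteArea K| - isoDeficit K

/-- The right-hand side `(64/9) ∫_{P ∉ K} (ω - 2 sin ω + sin 2ω - ¼ sin 4ω - sin³ ω) dP`. -/
def visualBound (K : Set Plane) : ℝ :=
  64 / 9 * ∫ P in Kᶜ, angleIntegrand (visualAngle K P)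

theorem hasDerivAt_of_coord {f : ℝ → Plane} {v : Plane} {θ : ℝ}
    (h : ∀ i, HasDerivAt (fun s => f s i) (v i) θ) : HasDerivAt f v θ := by
  have h1 : HasDerivAt (fun s => (f s).ofLp) v.ofLp θ := hasDerivAt_pi.2 h
  exact (PiLp.continuousLinearEquiv 2 ℝ (fun _ : Fin 2 => ℝ)).symm.hasFDerivAt.comp_hasDerivAt θ h1

theorem hasDerivAt_dirN (θ : ℝ) : HasDerivAt dirN (dirT θ) θ := by
  refine hasDerivAt_of_coord fun i => ?_
  fin_cases i
  · simpa [dirN, dirT] using Real.hasDerivAt_cos θ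
  · simpa [dirN, dirT] using Real.hasDerivAt_sin θ

theorem hasDerivAt_dirT (θ : ℝ) : HasDerivAt dirT (-dirN θ) θ := by
  refine hasDerivAt_of_coord fun i => ?_
  fin_cases i
  · simpa [dirN, dirT] using (Real.hasDerivAt_sin θ).fun_neg
  · simpa [dirN, dirT] using Real.hasDerivAt_cos θ

/-- The evolute consists of the centers of curvature. -/
theorem envelope_evoluteSupport (p : ℝ → ℝ) (φ : ℝ) :
    envelope (evoluteSupport p) (φ + Real.pi / 2) =
      envelope p φ - (p φ + deriv (deriv p) φ) • dirN φ := by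
  have h1 : deriv (evoluteSupport p) (φ + Real.pi / 2) = deriv (deriv p) φ := by
    have := deriv_comp_sub_const (f := deriv p) (a := Real.pi / 2) (x := φ + Real.pi / 2)
    rw [add_sub_cancel_right] at this
    exact this
  ext i
  fin_cases i <;>
    simp [envelope, h1, evoluteSupport, dirN, dirT, Real.cos_add_pi_div_two,
      Real.sin_add_pi_div_two] <;> ring

theorem hasDerivAt_envelope {f : ℝ → ℝ} (hf : ContDiff ℝ 2 f) (θ : ℝ) :
    HasDerivAt (envelope f) ((f θ + deriv (deriv f) θ) • dirT θ) θ := by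
  have h0 : HasDerivAt f (deriv f θ) θ := (hf.differentiable (by norm_num) θ).hasDerivAt
  have h1 : HasDerivAt (deriv f) (deriv (deriv f) θ) θ :=
    ((hf.iterate_deriv' 1 1).differentiable (by norm_num) θ).hasDerivAt
  have := (h0.smul (hasDerivAt_dirN θ)).add (h1.smul (hasDerivAt_dirT θ))
  refine this.congr_deriv ?_
  module

/-- For `f` of class `C²`, `signedArea f` is `½ ∮ (x dy - y dx)` along the envelope. -/
theorem signedArea_eq {f : ℝ → ℝ} (hf : ContDiff ℝ 2 f)
    (hper : Function.Periodic f (2 * Real.pi)) :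
    signedArea f = 1 / 2 * ∫ θ in (0 : ℝ)..(2 * Real.pi),
      (envelope f θ 0 * deriv (envelope f) θ 1 - envelope f θ 1 * deriv (envelope f) θ 0) := by
  have hd : ContDiff ℝ 1 (deriv f) := hf.iterate_deriv' 1 1
  have h0 : ∀ θ, HasDerivAt f (deriv f θ) θ :=
    fun θ => (hf.differentiable (by norm_num) θ).hasDerivAt
  have h1 : ∀ θ, HasDerivAt (deriv f) (deriv (deriv f) θ) θ :=
    fun θ => (hd.differentiable (by norm_num) θ).hasDerivAt
  have c0 : Continuous f := hf.continuous
  have c1 : Continuous (deriv f) := hd.continuous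
  have c2 : Continuous (deriv (deriv f)) := hd.continuous_deriv le_rfl
  have hper' : deriv f (2 * Real.pi) = deriv f 0 := by
    have h := deriv_comp_add_const (f := f) (a := 2 * Real.pi) (x := 0)
    have e : (fun x => f (x + 2 * Real.pi)) = f := funext hper
    rw [e] at h
    simpa using h.symm
  have hf0 : f (2 * Real.pi) = f 0 := by simpa using hper 0
  have key := intervalIntegral.integral_eq_sub_of_hasDerivAt (a := 0) (b := 2 * Real.pi)
    (f := fun θ => f θ * deriv f θ)
    (f' := fun θ => deriv f θ * deriv f θ + f θ * deriv (deriv f) θ)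
    (fun θ _ => (h0 θ).mul (h1 θ)) ((by fun_prop : Continuous _).intervalIntegrable _ _)
  rw [hper', hf0, sub_self] at key
  have e : ∀ θ, envelope f θ 0 * deriv (envelope f) θ 1 - envelope f θ 1 * deriv (envelope f) θ 0
      = (f θ ^ 2 - deriv f θ ^ 2) + (deriv f θ * deriv f θ + f θ * deriv (deriv f) θ) := by
    intro θ
    rw [(hasDerivAt_envelope hf θ).deriv]
    simp only [envelope, dirN, dirT, PiLp.add_apply, PiLp.smul_apply, smul_eq_mul]
    simp
    linear_combination (f θ * (f θ + deriv (deriv f) θ)) * Real.sin_sq_add_cos_sq θ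
  simp_rw [e]
  rw [intervalIntegral.integral_add ((by fun_prop : Continuous _).intervalIntegrable _ _)
    ((by fun_prop : Continuous _).intervalIntegrable _ _), key, add_zero]
  rfl

end HurwitzWidth

end

/-!
A point outside `K` is the intersection of the tangents with normal angles `φ` and `φ + τ`, where
`0 < τ < π`, exactly once, and its visual angle is `π - τ`. Let `h(φ, τ)` be the distance from the
point of tangency at `φ` to the tangent at `φ + τ`. In the coordinates `(φ, τ)`, an integration by
parts in `τ` turns the integral of `g(ω)`, for the function `g` of the theorem, into half of
`∫ κ(τ) ∫ h(φ, τ)² dφ dτ` with the weight `κ(τ) = g'(π - τ) / sin² τ`.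

For fixed `τ`, the function `h(·, τ)` depends linearly on the support function `p` and commutes with
translations, so Parseval's identity diagonalizes the integral over `φ`, as it does `|F_e|` and
`Δ`. Constant width kills the Fourier coefficients `cₙ` of `p` with `n ≠ 0` even. Of the remaining
frequencies, the weight `κ` annihilates `0`, `1` and `3` and contributes a multiple of `n² - 1` from
`5` on. With `eₙ = (4π²/9) (n² - 1) |cₙ|²` for `|n| ≥ 5` and `eₙ = 0` otherwise, the two sides of
the inequality are `∑ (n² - 9) eₙ` and `∑ 16 eₙ`. Their difference `∑ (n² - 25) eₙ` vanishes if
and only if `p` has no frequency above `5`.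

Finally, up to rotation and translation, the generalized support function of the hypocycloid with
ratio of radii `k` is a multiple of `sin (k φ / (k - 2))`, which has frequency `3` for `k = 3` and
`5` for `k = 5 / 2`.
-/

noncomputable section

namespace HurwitzWidth

open MeasureTheory Set Filter Topology Real

variable {f : ℝ → ℝ} {K : Set Plane} {φ τ t : ℝ}

/-! ### Curvature and distances to support lines -/

theorem hasDerivAt_of_contDiff_two (hf : ContDiff ℝ 2 f) (φ : ℝ) : HasDerivAt f (deriv f φ) φ :=
  (hf.differentiable two_ne_zero φ).hasDerivAt

theorem hasDerivAt_deriv_of_contDiff_two (hf : ContDiff ℝ 2 f) (φ : ℝ) :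
    HasDerivAt (deriv f) (deriv (deriv f) φ) φ :=
  ((hf.iterate_deriv' 1 1).differentiable one_ne_zero φ).hasDerivAt

theorem continuous_deriv_of_contDiff_two (hf : ContDiff ℝ 2 f) : Continuous (deriv f) :=
  hf.continuous_deriv one_le_two

theorem continuous_deriv_deriv_of_contDiff_two (hf : ContDiff ℝ 2 f) :
    Continuous (deriv (deriv f)) :=
  ContDiff.continuous_deriv_one (hf.iterate_deriv' 1 1)

theorem periodic_deriv {c : ℝ} (hper : Function.Periodic f c) : Function.Periodic (deriv f) c :=
  fun φ => by rw [← deriv_comp_add_const, hper.funext]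

/-- The signed radius of curvature, at the point with normal angle `φ`, of the curve with
generalized support function `f`. -/
def curvatureRadius (f : ℝ → ℝ) (φ : ℝ) : ℝ := f φ + deriv (deriv f) φ

theorem continuous_curvatureRadius (hf : ContDiff ℝ 2 f) : Continuous (curvatureRadius f) :=
  hf.continuous.add (continuous_deriv_deriv_of_contDiff_two hf)

theorem periodic_curvatureRadius {c : ℝ} (hper : Function.Periodic f c) :
    Function.Periodic (curvatureRadius f) c :=
  hper.add (periodic_deriv (periodic_deriv hper))

/-- The signed distance from the point with normal angle `φ` of the curve with generalized support
function `f` to the support line with normal angle `φ + τ`. -/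
def supportGap (f : ℝ → ℝ) (φ τ : ℝ) : ℝ :=
  f (φ + τ) - f φ * cos τ - deriv f φ * sin τ

@[simp] theorem supportGap_zero (f : ℝ → ℝ) (φ : ℝ) : supportGap f φ 0 = 0 := by
  simp [supportGap]

theorem periodic_supportGap (hper : Function.Periodic f (2 * π)) (φ : ℝ) :
    Function.Periodic (supportGap f φ) (2 * π) := fun τ => by
  simp only [supportGap, ← add_assoc, hper _, cos_add_two_pi, sin_add_two_pi]

theorem continuous_supportGap (hf : ContDiff ℝ 2 f) :
    Continuous fun x : ℝ × ℝ => supportGap f x.1 x.2 := by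
  have := hf.continuous
  have := continuous_deriv_of_contDiff_two hf
  unfold supportGap
  fun_prop

/-- The kernel is written in the rescaled variable `u` so that it is positive for both signs
of `τ`. -/
theorem supportGap_eq_integral (hf : ContDiff ℝ 2 f) (φ τ : ℝ) :
    supportGap f φ τ =
      ∫ u in (0 : ℝ)..1, curvatureRadius f (φ + u * τ) * (τ * sin (τ * (1 - u))) := by
  have hderiv (u : ℝ) : HasDerivAt
      (fun u => deriv f (φ + u * τ) * sin (τ * (1 - u)) + f (φ + u * τ) * cos (τ * (1 - u)))
      (curvatureRadius f (φ + u * τ) * (τ * sin (τ * (1 - u)))) u := by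
    have hin : HasDerivAt (fun u => φ + u * τ) τ u := by
      simpa using ((hasDerivAt_id u).mul_const τ).const_add φ
    have hang : HasDerivAt (fun u => τ * (1 - u)) (-τ) u := by
      simpa using ((hasDerivAt_id u).const_sub 1).const_mul τ
    have h := (((hasDerivAt_deriv_of_contDiff_two hf _).comp u hin).mul hang.sin).add
      (((hasDerivAt_of_contDiff_two hf _).comp u hin).mul hang.cos)
    refine h.congr_deriv ?_
    simp only [Function.comp_apply, curvatureRadius]
    ring
  have hcont := continuous_curvatureRadius hf
  rw [intervalIntegral.integral_eq_sub_of_hasDerivAt (fun u _ => hderiv u)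
    ((by fun_prop : Continuous _).intervalIntegrable _ _)]
  simp only [supportGap, one_mul, sub_self, mul_zero, sin_zero, cos_zero, zero_mul, add_zero,
    sub_zero, mul_one, zero_add]
  ring

theorem mul_sin_mul_pos {v : ℝ} (h0 : τ ≠ 0) (h1 : |τ| ≤ π) (hv : v ∈ Ioo 0 1) :
    0 < τ * sin (τ * v) := by
  obtain ⟨hv0, hv1⟩ := hv
  rw [abs_le] at h1
  rcases lt_or_gt_of_ne h0 with h | h
  · exact mul_pos_of_neg_of_neg h (sin_neg_of_neg_of_neg_pi_lt (by nlinarith) (by nlinarith))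
  · exact mul_pos h (sin_pos_of_pos_of_lt_pi (by positivity) (by nlinarith))

theorem supportGap_pos (hf : ContDiff ℝ 2 f) (hpos : ∀ x, 0 < curvatureRadius f x) (φ : ℝ)
    (h0 : τ ≠ 0) (h1 : |τ| ≤ π) : 0 < supportGap f φ τ := by
  have hcont := continuous_curvatureRadius hf
  rw [supportGap_eq_integral hf]
  refine intervalIntegral.intervalIntegral_pos_of_pos_on
    ((by fun_prop : Continuous _).intervalIntegrable _ _) (fun u hu => ?_) one_pos
  exact mul_pos (hpos _) (mul_sin_mul_pos h0 h1 ⟨by linarith [hu.2], by linarith [hu.1]⟩)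

theorem supportGap_pos_of_periodic (hf : ContDiff ℝ 2 f) (hper : Function.Periodic f (2 * π))
    (hpos : ∀ x, 0 < curvatureRadius f x) (φ : ℝ) (hτ : τ ∈ Ioo 0 (2 * π)) :
    0 < supportGap f φ τ := by
  obtain ⟨h0, h1⟩ := hτ
  rcases le_or_gt τ π with h | h
  · exact supportGap_pos hf hpos φ h0.ne' (by rwa [abs_of_pos h0])
  · rw [← (periodic_supportGap hper φ).sub_eq]
    exact supportGap_pos hf hpos φ (by linarith) (by rw [abs_le]; constructor <;> linarith)

theorem supportGap_const (M φ τ : ℝ) : supportGap (fun _ => M) φ τ = M * (1 - cos τ) := by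
  simp only [supportGap, deriv_const]
  ring

theorem abs_supportGap_le (hf : ContDiff ℝ 2 f) {M : ℝ} (hM : ∀ x, |curvatureRadius f x| ≤ M)
    (φ : ℝ) (hτ : |τ| ≤ π) : |supportGap f φ τ| ≤ M * (1 - cos τ) := by
  rcases eq_or_ne τ 0 with rfl | h0
  · simp
  rw [supportGap_eq_integral hf, ← supportGap_const M φ, supportGap_eq_integral contDiff_const]
  have hcont : Continuous (curvatureRadius fun _ => M) := continuous_curvatureRadius contDiff_const
  have hbound : Continuous fun u =>
      curvatureRadius (fun _ => M) (φ + u * τ) * (τ * sin (τ * (1 - u))) := by fun_prop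
  rw [← norm_eq_abs]
  refine intervalIntegral.norm_integral_le_of_norm_le (μ := volume) zero_le_one ?_
    (hbound.intervalIntegrable _ _)
  filter_upwards [Measure.ae_ne volume 1] with u hu1 hu
  have hkernel : 0 < τ * sin (τ * (1 - u)) :=
    mul_sin_mul_pos h0 hτ ⟨by linarith [lt_of_le_of_ne hu.2 hu1], by linarith [hu.1]⟩
  rw [Real.norm_eq_abs, abs_mul, abs_of_pos hkernel]
  refine mul_le_mul_of_nonneg_right ?_ hkernel.le
  simpa [curvatureRadius] using hM _

/-! ### The moving frame -/

theorem inner_plane (x y : Plane) : inner ℝ x y = x 0 * y 0 + x 1 * y 1 := by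
  simp [PiLp.inner_apply, Fin.sum_univ_two, mul_comm]

theorem plane_ext {x y : Plane} (h0 : x 0 = y 0) (h1 : x 1 = y 1) : x = y := by
  ext i
  fin_cases i
  exacts [h0, h1]

@[simp] theorem dirN_apply_zero (φ : ℝ) : dirN φ 0 = cos φ := by simp [dirN]
@[simp] theorem dirN_apply_one (φ : ℝ) : dirN φ 1 = sin φ := by simp [dirN]
@[simp] theorem dirT_apply_zero (φ : ℝ) : dirT φ 0 = -sin φ := by simp [dirT]
@[simp] theorem dirT_apply_one (φ : ℝ) : dirT φ 1 = cos φ := by simp [dirT]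

theorem dirN_periodic : Function.Periodic dirN (2 * π) := fun φ => by simp [dirN]
theorem dirT_periodic : Function.Periodic dirT (2 * π) := fun φ => by simp [dirT]

theorem dirN_add_pi (φ : ℝ) : dirN (φ + π) = -dirN φ := plane_ext (by simp) (by simp)

theorem contDiff_dirN {n : WithTop ℕ∞} : ContDiff ℝ n dirN := by
  rw [contDiff_euclidean]
  intro i
  fin_cases i
  · simpa using contDiff_cos
  · simpa using contDiff_sin

theorem inner_dirN (x : Plane) (φ : ℝ) : inner ℝ x (dirN φ) = x 0 * cos φ + x 1 * sin φ := by
  simp [inner_plane]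

theorem inner_dirT (x : Plane) (φ : ℝ) : inner ℝ x (dirT φ) = -(x 0 * sin φ) + x 1 * cos φ := by
  simp [inner_plane]

theorem inner_dirN_add (x : Plane) (φ τ : ℝ) : inner ℝ x (dirN (φ + τ)) =
    inner ℝ x (dirN φ) * cos τ + inner ℝ x (dirT φ) * sin τ := by
  simp only [inner_dirN, inner_dirT, cos_add, sin_add]
  ring

theorem inner_dirT_dirN (φ ψ : ℝ) : inner ℝ (dirT φ) (dirN ψ) = sin (ψ - φ) := by
  rw [inner_dirN, dirT_apply_zero, dirT_apply_one, sin_sub]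
  ring

theorem inner_dirT_dirT (φ ψ : ℝ) : inner ℝ (dirT φ) (dirT ψ) = cos (ψ - φ) := by
  rw [inner_dirT, dirT_apply_zero, dirT_apply_one, cos_sub]
  ring

theorem norm_sq_eq_inner_sq_add_inner_sq (x : Plane) (φ : ℝ) :
    ‖x‖ ^ 2 = inner ℝ x (dirN φ) ^ 2 + inner ℝ x (dirT φ) ^ 2 := by
  rw [EuclideanSpace.norm_sq_eq, Fin.sum_univ_two, inner_dirN, inner_dirT, norm_eq_abs,
    norm_eq_abs, sq_abs, sq_abs]
  linear_combination -(x 0 ^ 2 + x 1 ^ 2) * sin_sq_add_cos_sq φ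

theorem eq_of_inner_dirN_of_inner_dirT {x y : Plane} (φ : ℝ)
    (hN : inner ℝ x (dirN φ) = inner ℝ y (dirN φ))
    (hT : inner ℝ x (dirT φ) = inner ℝ y (dirT φ)) : x = y := by
  rw [← sub_eq_zero, ← norm_eq_zero, ← sq_eq_zero_iff, norm_sq_eq_inner_sq_add_inner_sq _ φ,
    inner_sub_left, inner_sub_left, hN, hT]
  simp

theorem norm_dirN (φ : ℝ) : ‖dirN φ‖ = 1 := by
  simp [EuclideanSpace.norm_eq, Fin.sum_univ_two]

theorem norm_dirT (φ : ℝ) : ‖dirT φ‖ = 1 := by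
  simp [EuclideanSpace.norm_eq, Fin.sum_univ_two]

theorem dirN_ne_zero (φ : ℝ) : dirN φ ≠ 0 := norm_ne_zero_iff.1 (by simp [norm_dirN])

theorem exists_eq_norm_smul_dirN (u : Plane) : ∃ θ, u = ‖u‖ • dirN θ := by
  have hnorm : ‖u‖ = ‖(⟨u 0, u 1⟩ : ℂ)‖ := by
    simp [EuclideanSpace.norm_eq, Complex.norm_eq_sqrt_sq_add_sq, Fin.sum_univ_two]
  refine ⟨Complex.arg ⟨u 0, u 1⟩, plane_ext ?_ ?_⟩
  · simp [hnorm, Complex.norm_mul_cos_arg]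
  · simp [hnorm, Complex.norm_mul_sin_arg]

theorem inner_envelope_dirN (f : ℝ → ℝ) (φ : ℝ) : inner ℝ (envelope f φ) (dirN φ) = f φ := by
  rw [envelope, inner_add_left, real_inner_smul_left, real_inner_smul_left, inner_dirT_dirN,
    real_inner_self_eq_norm_sq, norm_dirN]
  simp

theorem inner_envelope_dirT (f : ℝ → ℝ) (φ : ℝ) :
    inner ℝ (envelope f φ) (dirT φ) = deriv f φ := by
  rw [envelope, inner_add_left, real_inner_smul_left, real_inner_smul_left,
    real_inner_comm (dirT φ), inner_dirT_dirN, real_inner_self_eq_norm_sq, norm_dirT]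
  simp

theorem envelope_periodic (hper : Function.Periodic f (2 * π)) :
    Function.Periodic (envelope f) (2 * π) := fun φ => by
  simp only [envelope, hper φ, periodic_deriv hper φ, dirN_periodic φ, dirT_periodic φ]

/-! ### The support function of a compact convex set -/

theorem inner_le_supportFun (hK : IsCompact K) {x : Plane} (hx : x ∈ K) (φ : ℝ) :
    inner ℝ x (dirN φ) ≤ supportFun K φ :=
  le_csSup (hK.image (by fun_prop : Continuous fun x : Plane => inner ℝ x (dirN φ))).bddAbove
    (mem_image_of_mem _ hx)

theorem exists_inner_eq_supportFun (hne : K.Nonempty) (hK : IsCompact K) (φ : ℝ) :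
    ∃ x ∈ K, inner ℝ x (dirN φ) = supportFun K φ :=
  (hK.image (by fun_prop : Continuous fun x : Plane => inner ℝ x (dirN φ))).sSup_mem
    (hne.image _)

theorem supportFun_periodic (K : Set Plane) : Function.Periodic (supportFun K) (2 * π) :=
  fun φ => by simp only [supportFun, dirN_periodic φ]

theorem supportFun_closedBall (c : Plane) {R : ℝ} (hR : 0 ≤ R) (φ : ℝ) :
    supportFun (Metric.closedBall c R) φ = inner ℝ c (dirN φ) + R := by
  apply le_antisymm
  · refine csSup_le ((Metric.nonempty_closedBall.2 hR).image _) (forall_mem_image.2 fun x hx => ?_)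
    have hinner : inner ℝ (x - c) (dirN φ) ≤ ‖x - c‖ * ‖dirN φ‖ := real_inner_le_norm _ _
    rw [norm_dirN, mul_one, inner_sub_left] at hinner
    linarith [mem_closedBall_iff_norm.1 hx]
  · have hmem : c + R • dirN φ ∈ Metric.closedBall c R := by
      simp [norm_smul, norm_dirN, abs_of_nonneg hR]
    have hinner := inner_le_supportFun (isCompact_closedBall c R) hmem φ
    rwa [inner_add_left, real_inner_smul_left, real_inner_self_eq_norm_sq, norm_dirN, one_pow,
      mul_one] at hinner

theorem mem_iff_forall_inner_le_supportFun (hne : K.Nonempty) (hK : IsCompact K)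
    (hconv : Convex ℝ K) {x : Plane} :
    x ∈ K ↔ ∀ φ, inner ℝ x (dirN φ) ≤ supportFun K φ := by
  refine ⟨inner_le_supportFun hK, fun h => ?_⟩
  by_contra hx
  obtain ⟨ℓ, u, hu, hux⟩ := geometric_hahn_banach_closed_point hconv hK.isClosed hx
  obtain ⟨v, rfl⟩ := (InnerProductSpace.toDual ℝ Plane).surjective ℓ
  obtain ⟨θ, hθ⟩ := exists_eq_norm_smul_dirN v
  obtain ⟨y, hy, hyθ⟩ := exists_inner_eq_supportFun hne hK θ
  have hlt := (hu y hy).trans hux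
  rw [InnerProductSpace.toDual_apply_apply, InnerProductSpace.toDual_apply_apply, hθ,
    real_inner_smul_left, real_inner_smul_left, real_inner_comm, hyθ, real_inner_comm x] at hlt
  exact hlt.not_ge (mul_le_mul_of_nonneg_left (h θ) (norm_nonneg v))

theorem eq_of_supportFun_eq {K' : Set Plane} (hne : K.Nonempty) (hK : IsCompact K)
    (hconv : Convex ℝ K) (hne' : K'.Nonempty) (hK' : IsCompact K') (hconv' : Convex ℝ K')
    (h : supportFun K = supportFun K') : K = K' := by
  ext x
  rw [mem_iff_forall_inner_le_supportFun hne hK hconv,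
    mem_iff_forall_inner_le_supportFun hne' hK' hconv', h]

/-- The function `θ ↦ p θ - ⟨x, N θ⟩` is nonnegative and vanishes at `φ`, so its derivative vanishes
there. -/
theorem eq_envelope_of_inner_eq_supportFun (hK : IsCompact K) (hp : ContDiff ℝ 2 (supportFun K))
    {x : Plane} (hx : x ∈ K) (h : inner ℝ x (dirN φ) = supportFun K φ) :
    x = envelope (supportFun K) φ := by
  refine eq_of_inner_dirN_of_inner_dirT φ (by rw [h, inner_envelope_dirN]) ?_
  rw [inner_envelope_dirT]
  have hderiv : HasDerivAt (fun θ => supportFun K θ - inner ℝ x (dirN θ))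
      (deriv (supportFun K) φ - inner ℝ x (dirT φ)) φ := by
    refine (hasDerivAt_of_contDiff_two hp φ).sub ?_
    simpa using (hasDerivAt_const φ x).inner ℝ (hasDerivAt_dirN φ)
  have hmin : IsLocalMin (fun θ => supportFun K θ - inner ℝ x (dirN θ)) φ :=
    Eventually.of_forall fun θ => by simpa [h] using inner_le_supportFun hK hx θ
  linarith [hmin.hasDerivAt_eq_zero hderiv]

theorem envelope_mem (hne : K.Nonempty) (hK : IsCompact K) (hp : ContDiff ℝ 2 (supportFun K))
    (φ : ℝ) : envelope (supportFun K) φ ∈ K := by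
  obtain ⟨x, hx, h⟩ := exists_inner_eq_supportFun hne hK φ
  rwa [← eq_envelope_of_inner_eq_supportFun hK hp hx h]

theorem image_inner_dirN_eq_Icc (hne : K.Nonempty) (hK : IsCompact K) (hconv : Convex ℝ K)
    (φ : ℝ) : (fun x : Plane => inner ℝ x (dirN φ)) '' K =
      Icc (-supportFun K (φ + π)) (supportFun K φ) := by
  have hcont : Continuous fun x : Plane => inner ℝ x (dirN φ) := by fun_prop
  have hinf : sInf ((fun x : Plane => inner ℝ x (dirN φ)) '' K) = -supportFun K (φ + π) := by
    rw [sInf_def, supportFun, dirN_add_pi, ← image_neg_eq_neg, image_image]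
    simp only [inner_neg_right]
  rw [← hinf]
  exact eq_Icc_of_connected_compact ⟨hne.image _, hconv.isPreconnected.image _ hcont.continuousOn⟩
    (hK.image hcont)

theorem exists_supportFun_add_pi_eq (hne : K.Nonempty) (hK : IsCompact K) (hconv : Convex ℝ K)
    (hw : HasConstantWidth K) : ∃ w, ∀ φ, supportFun K φ + supportFun K (φ + π) = w := by
  obtain ⟨w, hw⟩ := hw
  refine ⟨w, fun φ => ?_⟩
  have himage := image_inner_dirN_eq_Icc hne hK hconv φ
  have hle := nonempty_Icc.1 (himage ▸ hne.image _)
  rw [← hw φ, himage, volume_real_Icc_of_le hle, sub_neg_eq_add]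

/-! ### Coordinates on the exterior of a convex set -/

/-- The point at signed distance `t` from the point of tangency on the oriented tangent with normal
angle `φ` of the curve with support function `f`. For `t > 0` these points sweep out the exterior of
the curve. -/
def tangentPoint (f : ℝ → ℝ) (φ t : ℝ) : Plane := envelope f φ + t • dirT φ

theorem inner_tangentPoint_dirN (f : ℝ → ℝ) (φ t : ℝ) :
    inner ℝ (tangentPoint f φ t) (dirN φ) = f φ := by
  simp [tangentPoint, inner_add_left, real_inner_smul_left, inner_envelope_dirN, inner_dirT_dirN]

theorem inner_tangentPoint_dirT (f : ℝ → ℝ) (φ t : ℝ) :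
    inner ℝ (tangentPoint f φ t) (dirT φ) = deriv f φ + t := by
  simp [tangentPoint, inner_add_left, real_inner_smul_left, inner_envelope_dirT, norm_dirT]

theorem sub_inner_tangentPoint (f : ℝ → ℝ) (φ t τ : ℝ) :
    f (φ + τ) - inner ℝ (tangentPoint f φ t) (dirN (φ + τ)) = supportGap f φ τ - t * sin τ := by
  rw [inner_dirN_add, inner_tangentPoint_dirN, inner_tangentPoint_dirT, supportGap]
  ring

theorem eq_tangentPoint {P : Plane} (h : inner ℝ P (dirN φ) = f φ) :
    P = tangentPoint f φ (inner ℝ P (dirT φ) - deriv f φ) := by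
  refine eq_of_inner_dirN_of_inner_dirT φ ?_ ?_
  · rw [inner_tangentPoint_dirN, h]
  · rw [inner_tangentPoint_dirT, add_sub_cancel]

theorem tangentPoint_injective (f : ℝ → ℝ) (φ : ℝ) : Function.Injective (tangentPoint f φ) :=
  fun t s h => by simpa [inner_tangentPoint_dirT] using congrArg (inner ℝ · (dirT φ)) h

theorem tangentPoint_periodic (hper : Function.Periodic f (2 * π)) (t : ℝ) :
    Function.Periodic (fun φ => tangentPoint f φ t) (2 * π) := fun φ => by
  simp only [tangentPoint, envelope_periodic hper φ, dirT_periodic φ]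

theorem mem_Ioo_pi_of_supportGap_le (hf : ContDiff ℝ 2 f) (hper : Function.Periodic f (2 * π))
    (hpos : ∀ x, 0 < curvatureRadius f x) (ht : 0 < t) (hτ : τ ∈ Ioo 0 (2 * π))
    (h : supportGap f φ τ ≤ t * sin τ) : τ ∈ Ioo 0 π := by
  have hsin : 0 < sin τ :=
    pos_of_mul_pos_right ((supportGap_pos_of_periodic hf hper hpos φ hτ).trans_le h) ht.le
  refine ⟨hτ.1, ?_⟩
  by_contra! hle
  rw [← sin_sub_two_pi] at hsin
  exact hsin.not_ge (sin_nonpos_of_nonpos_of_neg_pi_le (by linarith [hτ.2]) (by linarith))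

theorem sub_mem_Ioo_pi_of_tangentPoint_eq (hf : ContDiff ℝ 2 f)
    (hper : Function.Periodic f (2 * π)) (hpos : ∀ x, 0 < curvatureRadius f x) {ψ s : ℝ}
    (hψ : ψ ∈ Ioo φ (φ + 2 * π)) (ht : 0 < t) (h : tangentPoint f φ t = tangentPoint f ψ s) :
    ψ - φ ∈ Ioo 0 π := by
  refine mem_Ioo_pi_of_supportGap_le (φ := φ) hf hper hpos ht
    ⟨by linarith [hψ.1], by linarith [hψ.2]⟩ ?_
  have hgap := sub_inner_tangentPoint f φ t (ψ - φ)
  rw [add_sub_cancel, h, inner_tangentPoint_dirN] at hgap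
  linarith

theorem tangentPoint_injOn (hf : ContDiff ℝ 2 f) (hper : Function.Periodic f (2 * π))
    (hpos : ∀ x, 0 < curvatureRadius f x) :
    InjOn (fun x : ℝ × ℝ => tangentPoint f x.1 x.2) (Ico 0 (2 * π) ×ˢ Ioi 0) := by
  rintro ⟨φ, t⟩ ⟨hφ, ht⟩ ⟨ψ, s⟩ ⟨hψ, hs⟩ (h : tangentPoint f φ t = tangentPoint f ψ s)
  rw [mem_Ioi] at ht hs
  wlog hle : φ ≤ ψ generalizing φ ψ t s
  · exact (this ψ s hψ hs φ t hφ ht h.symm (le_of_not_ge hle)).symm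
  obtain rfl | hlt := hle.eq_or_lt
  · rw [tangentPoint_injective f φ h]
  have hφψ := sub_mem_Ioo_pi_of_tangentPoint_eq hf hper hpos
    ⟨hlt, by linarith [hφ.1, hψ.2]⟩ ht h
  have hψφ := sub_mem_Ioo_pi_of_tangentPoint_eq hf hper hpos (ψ := φ + 2 * π) (s := t)
    ⟨by linarith [hφ.1, hψ.2], by linarith⟩ hs (h.symm.trans (tangentPoint_periodic hper t φ).symm)
  linarith [hφψ.2, hψφ.2]

theorem tangentPoint_notMem (hK : IsStrictlyConvexC2 K) (φ : ℝ) (ht : 0 < t) :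
    tangentPoint (supportFun K) φ t ∉ K := fun h => by
  have henv := eq_envelope_of_inner_eq_supportFun hK.isCompact hK.contDiff h
    (inner_tangentPoint_dirN _ φ t)
  have hinner := inner_tangentPoint_dirT (supportFun K) φ t
  rw [henv, inner_envelope_dirT] at hinner
  linarith

/-- Turning back from a line that separates `P` from the curve, one meets a tangent through `P`. -/
theorem exists_eq_tangentPoint (hf : ContDiff ℝ 2 f) (hper : Function.Periodic f (2 * π))
    (hpos : ∀ x, 0 < curvatureRadius f x) {P : Plane} {θ : ℝ} (hθ : f θ < inner ℝ P (dirN θ)) :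
    ∃ φ ∈ Ico 0 (2 * π), ∃ t, 0 < t ∧ P = tangentPoint f φ t := by
  have hcont : Continuous fun s => f s - inner ℝ P (dirN s) :=
    hf.continuous.sub (continuous_const.inner (contDiff_dirN (n := 0)).continuous)
  have hopposite : 0 < f (θ - π) - inner ℝ P (dirN (θ - π)) := by
    have hgap := supportGap_pos hf hpos (θ - π) pi_ne_zero (abs_of_pos pi_pos).le
    have hN : dirN (θ - π) = -dirN θ := by rw [← sub_add_cancel θ π, dirN_add_pi]; simp
    rw [supportGap, sub_add_cancel, cos_pi, sin_pi] at hgap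
    rw [hN, inner_neg_right]
    linarith
  obtain ⟨φ, ⟨hle, hge⟩, hφ⟩ := intermediate_value_Ioo' (by linarith [pi_pos] : θ - π ≤ θ)
    hcont.continuousOn ⟨(by linarith : f θ - inner ℝ P (dirN θ) < 0), hopposite⟩
  have hP := eq_tangentPoint (sub_eq_zero.1 hφ).symm
  set t := inner ℝ P (dirT φ) - deriv f φ
  have ht : 0 < t := by
    have hgap := supportGap_pos hf hpos φ (sub_pos.2 hge).ne'
      (by rw [abs_of_pos (sub_pos.2 hge)]; linarith)
    have hsub := sub_inner_tangentPoint f φ t (θ - φ)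
    rw [← hP, add_sub_cancel] at hsub
    exact pos_of_mul_pos_left (by linarith : 0 < t * sin (θ - φ))
      (sin_pos_of_pos_of_lt_pi (sub_pos.2 hge) (by linarith)).le
  obtain ⟨ψ, hψ, hφψ⟩ := (tangentPoint_periodic hper t).exists_mem_Ico₀ two_pi_pos φ
  exact ⟨ψ, hψ, t, ht, hP.trans hφψ⟩

theorem image_tangentPoint (hK : IsStrictlyConvexC2 K) :
    (fun x : ℝ × ℝ => tangentPoint (supportFun K) x.1 x.2) '' (Ico 0 (2 * π) ×ˢ Ioi 0) = Kᶜ := by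
  refine Subset.antisymm (image_subset_iff.2 fun x hx => tangentPoint_notMem hK _ hx.2) ?_
  intro P hP
  rw [mem_compl_iff, mem_iff_forall_inner_le_supportFun hK.nonempty hK.isCompact hK.convex] at hP
  push Not at hP
  obtain ⟨θ, hθ⟩ := hP
  obtain ⟨φ, hφ, t, ht, rfl⟩ :=
    exists_eq_tangentPoint hK.contDiff (supportFun_periodic K) hK.radius_pos hθ
  exact ⟨(φ, t), ⟨hφ, ht⟩, rfl⟩

/-! ### Intersections of two tangents -/

/-- The length of the tangent with normal angle `φ` up to its intersection with the tangent with
normal angle `φ + τ`. -/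
def tangentLength (f : ℝ → ℝ) (φ τ : ℝ) : ℝ := supportGap f φ τ / sin τ

theorem hasFDerivAt_supportGap (hf : ContDiff ℝ 2 f) (x : ℝ × ℝ) :
    ∃ a : ℝ, HasFDerivAt (fun x : ℝ × ℝ => supportGap f x.1 x.2)
      (a • ContinuousLinearMap.fst ℝ ℝ ℝ + (deriv f (x.1 + x.2) + f x.1 * sin x.2 -
        deriv f x.1 * cos x.2) • ContinuousLinearMap.snd ℝ ℝ ℝ) x := by
  have hfst : HasFDerivAt (fun x : ℝ × ℝ => x.1) (ContinuousLinearMap.fst ℝ ℝ ℝ) x :=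
    hasFDerivAt_fst
  have hsnd : HasFDerivAt (fun x : ℝ × ℝ => x.2) (ContinuousLinearMap.snd ℝ ℝ ℝ) x :=
    hasFDerivAt_snd
  have hadd := (hasDerivAt_of_contDiff_two hf (x.1 + x.2)).comp_hasFDerivAt x (hfst.add hsnd)
  have hcos := ((hasDerivAt_of_contDiff_two hf x.1).comp_hasFDerivAt x hfst).mul
    ((hasDerivAt_cos x.2).comp_hasFDerivAt x hsnd)
  have hsin := ((hasDerivAt_deriv_of_contDiff_two hf x.1).comp_hasFDerivAt x hfst).mul
    ((hasDerivAt_sin x.2).comp_hasFDerivAt x hsnd)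
  refine ⟨deriv f (x.1 + x.2) - deriv f x.1 * cos x.2 - deriv (deriv f) x.1 * sin x.2,
    ((hadd.sub hcos).sub hsin).congr_fderiv ?_⟩
  ext
  · simp; ring
  · simp

theorem supportGap_reverse (f : ℝ → ℝ) (φ τ : ℝ) : supportGap f (φ + τ) (-τ) =
    (deriv f (φ + τ) + f φ * sin τ - deriv f φ * cos τ) * sin τ - supportGap f φ τ * cos τ := by
  rw [supportGap, supportGap, add_neg_cancel_right, cos_neg, sin_neg]
  linear_combination -f φ * sin_sq_add_cos_sq τ

theorem hasFDerivAt_tangentLength (hf : ContDiff ℝ 2 f) {x : ℝ × ℝ} (hx : sin x.2 ≠ 0) :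
    ∃ a : ℝ, HasFDerivAt (fun x : ℝ × ℝ => tangentLength f x.1 x.2)
      (a • ContinuousLinearMap.fst ℝ ℝ ℝ + (supportGap f (x.1 + x.2) (-x.2) / sin x.2 ^ 2) •
        ContinuousLinearMap.snd ℝ ℝ ℝ) x := by
  obtain ⟨a, ha⟩ := hasFDerivAt_supportGap hf x
  have hinv := ((hasDerivAt_sin x.2).inv hx).comp_hasFDerivAt x
    (hasFDerivAt_snd (𝕜 := ℝ) (E := ℝ) (F := ℝ))
  refine ⟨a / sin x.2, (ha.mul hinv).congr_fderiv ?_⟩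
  rw [supportGap_reverse]
  ext
  · simp; field_simp
  · simp; field_simp; ring

theorem hasDerivAt_tangentLength (hf : ContDiff ℝ 2 f) (φ : ℝ) (hτ : sin τ ≠ 0) :
    HasDerivAt (tangentLength f φ) (supportGap f (φ + τ) (-τ) / sin τ ^ 2) τ := by
  obtain ⟨a, ha⟩ := hasFDerivAt_tangentLength hf (x := (φ, τ)) hτ
  have hmk : HasDerivAt (fun s : ℝ => (φ, s)) (0, 1) τ :=
    (hasDerivAt_const τ φ).prodMk (hasDerivAt_id τ)
  exact (ha.comp_hasDerivAt τ hmk).congr_deriv (by simp)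

theorem continuousOn_tangentLength (hf : ContDiff ℝ 2 f) (φ : ℝ) :
    ContinuousOn (tangentLength f φ) (Ioo 0 π) := fun _ hτ =>
  (hasDerivAt_tangentLength hf φ (sin_pos_of_mem_Ioo hτ).ne').continuousAt.continuousWithinAt

theorem strictMonoOn_tangentLength (hf : ContDiff ℝ 2 f) (hpos : ∀ x, 0 < curvatureRadius f x)
    (φ : ℝ) : StrictMonoOn (tangentLength f φ) (Ioo 0 π) := by
  refine strictMonoOn_of_deriv_pos (convex_Ioo _ _) (continuousOn_tangentLength hf φ) ?_
  intro τ hτ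
  rw [interior_Ioo] at hτ
  have hsin := sin_pos_of_mem_Ioo hτ
  rw [(hasDerivAt_tangentLength hf φ hsin.ne').deriv]
  refine div_pos (supportGap_pos hf hpos _ (neg_ne_zero.2 hτ.1.ne') ?_) (pow_pos hsin 2)
  rw [abs_neg, abs_of_pos hτ.1]
  exact hτ.2.le

theorem tangentLength_pos (hf : ContDiff ℝ 2 f) (hpos : ∀ x, 0 < curvatureRadius f x) (φ : ℝ)
    (hτ : τ ∈ Ioo 0 π) : 0 < tangentLength f φ τ :=
  div_pos (supportGap_pos hf hpos φ hτ.1.ne' (by rw [abs_of_pos hτ.1]; exact hτ.2.le))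
    (sin_pos_of_mem_Ioo hτ)

theorem tendsto_tangentLength_zero (hf : ContDiff ℝ 2 f) (φ : ℝ) :
    Tendsto (tangentLength f φ) (𝓝[>] 0) (𝓝 0) := by
  have hderiv (τ : ℝ) : HasDerivAt (supportGap f φ)
      (deriv f (φ + τ) + f φ * sin τ - deriv f φ * cos τ) τ := by
    have hadd := (hasDerivAt_of_contDiff_two hf (φ + τ)).comp_const_add φ τ
    refine ((hadd.sub ((hasDerivAt_cos τ).const_mul (f φ))).sub
      ((hasDerivAt_sin τ).const_mul (deriv f φ))).congr_deriv ?_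
    ring
  have hgap : Tendsto (fun τ => τ⁻¹ * supportGap f φ τ) (𝓝[≠] 0) (𝓝 0) := by
    simpa [hasDerivAt_iff_tendsto_slope, slope_fun_def, supportGap_zero] using hderiv 0
  have hsin : Tendsto (fun τ => τ⁻¹ * sin τ) (𝓝[≠] 0) (𝓝 1) := by
    simpa [hasDerivAt_iff_tendsto_slope, slope_fun_def] using hasDerivAt_sin 0
  have hdiv := (hgap.div hsin one_ne_zero).mono_left (nhdsGT_le_nhdsNE 0)
  rw [zero_div] at hdiv
  refine hdiv.congr' ?_
  filter_upwards [self_mem_nhdsWithin] with τ hτ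
  exact mul_div_mul_left _ _ (inv_ne_zero (ne_of_gt hτ))

theorem tendsto_tangentLength_pi (hf : ContDiff ℝ 2 f) (hpos : ∀ x, 0 < curvatureRadius f x)
    (φ : ℝ) : Tendsto (tangentLength f φ) (𝓝[<] π) atTop := by
  have hgap : Tendsto (supportGap f φ) (𝓝[<] π) (𝓝 (supportGap f φ π)) :=
    ((continuous_supportGap hf).comp (Continuous.prodMk_right φ)).continuousAt.mono_left
      nhdsWithin_le_nhds
  have hsin : Tendsto sin (𝓝[<] π) (𝓝[>] 0) := by
    refine tendsto_nhdsWithin_iff.2 ⟨?_, ?_⟩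
    · simpa using continuous_sin.continuousAt.mono_left (nhdsWithin_le_nhds (a := π))
    · filter_upwards [Ioo_mem_nhdsLT pi_pos] with τ hτ using sin_pos_of_mem_Ioo hτ
  exact hgap.pos_mul_atTop (supportGap_pos hf hpos φ pi_ne_zero (abs_of_pos pi_pos).le)
    (tendsto_inv_nhdsGT_zero.comp hsin)

theorem Ioi_subset_image_tangentLength (hf : ContDiff ℝ 2 f)
    (hpos : ∀ x, 0 < curvatureRadius f x) (φ : ℝ) : Ioi 0 ⊆ tangentLength f φ '' Ioo 0 π :=
  isPreconnected_Ioo.intermediate_value_Ioi (le_principal_iff.2 (Ioo_mem_nhdsGT pi_pos))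
    (le_principal_iff.2 (Ioo_mem_nhdsLT pi_pos)) (continuousOn_tangentLength hf φ)
    (tendsto_tangentLength_zero hf φ) (tendsto_tangentLength_pi hf hpos φ)

/-- The intersection of the tangents with normal angles `x.1` and `x.1 + x.2`. -/
def tangentMeet (f : ℝ → ℝ) (x : ℝ × ℝ) : Plane := tangentPoint f x.1 (tangentLength f x.1 x.2)

theorem inner_tangentMeet_dirN (f : ℝ → ℝ) (φ τ : ℝ) :
    inner ℝ (tangentMeet f (φ, τ)) (dirN φ) = f φ := inner_tangentPoint_dirN f φ _

theorem inner_tangentMeet_dirN_add (φ : ℝ) (hτ : sin τ ≠ 0) :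
    inner ℝ (tangentMeet f (φ, τ)) (dirN (φ + τ)) = f (φ + τ) := by
  have hsub := sub_inner_tangentPoint f φ (tangentLength f φ τ) τ
  rw [tangentLength, div_mul_cancel₀ _ hτ, sub_self, sub_eq_zero] at hsub
  exact hsub.symm

theorem eq_tangentMeet {P : Plane} (hτ : sin τ ≠ 0) (h : inner ℝ P (dirN φ) = f φ)
    (h' : inner ℝ P (dirN (φ + τ)) = f (φ + τ)) : P = tangentMeet f (φ, τ) := by
  have hsub := sub_inner_tangentPoint f φ (inner ℝ P (dirT φ) - deriv f φ) τ
  rw [← eq_tangentPoint h, h', sub_self] at hsub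
  rw [tangentMeet, tangentLength, (div_eq_iff hτ).2 (sub_eq_zero.1 hsub.symm)]
  exact eq_tangentPoint h

theorem tangentMeet_reverse (φ : ℝ) (hτ : sin τ ≠ 0) :
    tangentMeet f (φ + τ, -τ) = tangentMeet f (φ, τ) := by
  refine (eq_tangentMeet (by simpa using hτ) (inner_tangentMeet_dirN_add φ hτ) ?_).symm
  rw [add_neg_cancel_right, inner_tangentMeet_dirN]

theorem tangentMeet_injOn (hf : ContDiff ℝ 2 f) (hper : Function.Periodic f (2 * π))
    (hpos : ∀ x, 0 < curvatureRadius f x) :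
    InjOn (tangentMeet f) (Ico 0 (2 * π) ×ˢ Ioo 0 π) := by
  rintro ⟨φ, τ⟩ ⟨hφ, hτ⟩ ⟨ψ, σ⟩ ⟨hψ, hσ⟩ h
  have hpair := tangentPoint_injOn hf hper hpos
    (mk_mem_prod hφ (mem_Ioi.2 (tangentLength_pos hf hpos φ hτ)))
    (mk_mem_prod hψ (mem_Ioi.2 (tangentLength_pos hf hpos ψ hσ))) h
  simp only [Prod.mk.injEq] at hpair
  obtain ⟨rfl, hlength⟩ := hpair
  exact congrArg (Prod.mk φ) ((strictMonoOn_tangentLength hf hpos φ).injOn hτ hσ hlength)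

theorem image_tangentMeet (hK : IsStrictlyConvexC2 K) :
    tangentMeet (supportFun K) '' (Ico 0 (2 * π) ×ˢ Ioo 0 π) = Kᶜ := by
  rw [← image_tangentPoint hK]
  refine Subset.antisymm (image_subset_iff.2 fun x hx => ?_) (image_subset_iff.2 fun x hx => ?_)
  · exact ⟨(x.1, tangentLength (supportFun K) x.1 x.2),
      ⟨hx.1, tangentLength_pos hK.contDiff hK.radius_pos _ hx.2⟩, rfl⟩
  · obtain ⟨τ, hτ, hlength⟩ :=
      Ioi_subset_image_tangentLength hK.contDiff hK.radius_pos x.1 hx.2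
    exact ⟨(x.1, τ), ⟨hx.1, hτ⟩, by rw [tangentMeet, hlength]⟩

theorem inner_tangentMeet_eq_iff (hf : ContDiff ℝ 2 f) (hper : Function.Periodic f (2 * π))
    (hpos : ∀ x, 0 < curvatureRadius f x) (φ : ℝ) (hτ : τ ∈ Ioo 0 π) {σ : ℝ}
    (hσ : σ ∈ Ico 0 (2 * π)) :
    inner ℝ (tangentMeet f (φ, τ)) (dirN (φ + σ)) = f (φ + σ) ↔ σ = 0 ∨ σ = τ := by
  constructor
  · intro h
    refine or_iff_not_imp_left.2 fun hσ0 => ?_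
    have hgap := sub_inner_tangentPoint f φ (tangentLength f φ τ) σ
    rw [← tangentMeet.eq_1 f (φ, τ), h, sub_self, eq_comm, sub_eq_zero] at hgap
    have hσpi := mem_Ioo_pi_of_supportGap_le hf hper hpos (tangentLength_pos hf hpos φ hτ)
      ⟨hσ.1.lt_of_ne' hσ0, hσ.2⟩ hgap.le
    refine (strictMonoOn_tangentLength hf hpos φ).injOn hσpi hτ ?_
    exact (div_eq_iff (sin_pos_of_mem_Ioo hσpi).ne').2 hgap
  · rintro (rfl | rfl)
    · rw [add_zero, inner_tangentMeet_dirN]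
    · exact inner_tangentMeet_dirN_add φ (sin_pos_of_mem_Ioo hτ).ne'

/-! ### The visual angle -/

theorem tangencyPoints_eq_image (hne : K.Nonempty) (hK : IsCompact K)
    (hp : ContDiff ℝ 2 (supportFun K)) (P : Plane) :
    tangencyPoints K P =
      envelope (supportFun K) '' {θ | inner ℝ P (dirN θ) = supportFun K θ} := by
  ext x
  constructor
  · rintro ⟨hx, u, hu0, hux, hu⟩
    obtain ⟨θ, hθ⟩ := exists_eq_norm_smul_dirN u
    have hu0 : 0 < ‖u‖ := norm_pos_iff.2 hu0
    obtain ⟨y, hy, hyθ⟩ := exists_inner_eq_supportFun hne hK θ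
    have hle := hu y hy
    rw [hθ, real_inner_smul_left, mul_eq_zero, or_iff_right hu0.ne', real_inner_comm,
      inner_sub_left, sub_eq_zero] at hux
    rw [hθ, real_inner_smul_left, real_inner_comm, inner_sub_left, hyθ] at hle
    have hle := nonpos_of_mul_nonpos_right hle hu0
    have hge := inner_le_supportFun hK hx θ
    exact ⟨θ, show _ = _ by linarith,
      (eq_envelope_of_inner_eq_supportFun hK hp hx (by linarith)).symm⟩
  · rintro ⟨θ, hθ, rfl⟩
    refine ⟨envelope_mem hne hK hp θ, dirN θ, dirN_ne_zero θ, ?_, fun y hy => ?_⟩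
    · rw [real_inner_comm, inner_sub_left, inner_envelope_dirN, hθ, sub_self]
    · rw [real_inner_comm, inner_sub_left, hθ]
      exact sub_nonpos.2 (inner_le_supportFun hK hy θ)

theorem tangencyPoints_tangentMeet (hK : IsStrictlyConvexC2 K) (φ : ℝ) (hτ : τ ∈ Ioo 0 π) :
    tangencyPoints K (tangentMeet (supportFun K) (φ, τ)) =
      {envelope (supportFun K) φ, envelope (supportFun K) (φ + τ)} := by
  have hper := supportFun_periodic K
  have hiff (σ : ℝ) (hσ : σ ∈ Ico 0 (2 * π)) :=
    inner_tangentMeet_eq_iff hK.contDiff hper hK.radius_pos φ hτ hσ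
  rw [tangencyPoints_eq_image hK.nonempty hK.isCompact hK.contDiff]
  set P := tangentMeet (supportFun K) (φ, τ)
  refine Subset.antisymm ?_ ?_
  · rintro _ ⟨θ, hθ, rfl⟩
    obtain ⟨ψ, hψ, hθψ⟩ : ∃ ψ ∈ Ico φ (φ + 2 * π), _ :=
      Function.Periodic.exists_mem_Ico (f := fun s =>
        (envelope (supportFun K) s, supportFun K s, inner ℝ P (dirN s)))
        (fun s => by simp only [envelope_periodic hper s, hper s, dirN_periodic s])
        two_pi_pos θ φ
    simp only [Prod.mk.injEq] at hθψ
    obtain ⟨σ, rfl⟩ : ∃ σ, ψ = φ + σ := ⟨ψ - φ, by ring⟩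
    rw [mem_ofPred_eq, hθψ.2.1, hθψ.2.2,
      hiff σ ⟨by linarith [hψ.1], by linarith [hψ.2]⟩] at hθ
    rw [hθψ.1]
    rcases hθ with rfl | rfl <;> simp
  · rintro _ (rfl | rfl)
    · exact mem_image_of_mem _ (inner_tangentMeet_dirN _ φ τ)
    · exact mem_image_of_mem _ (inner_tangentMeet_dirN_add φ (sin_pos_of_mem_Ioo hτ).ne')

theorem angle_envelope_tangentMeet (hf : ContDiff ℝ 2 f) (hpos : ∀ x, 0 < curvatureRadius f x)
    (φ : ℝ) (hτ : τ ∈ Ioo 0 π) :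
    EuclideanGeometry.angle (envelope f φ) (tangentMeet f (φ, τ)) (envelope f (φ + τ)) =
      π - τ := by
  have hsub (ψ σ : ℝ) :
      envelope f ψ - tangentMeet f (ψ, σ) = -tangentLength f ψ σ • dirT ψ := by
    rw [tangentMeet, tangentPoint]
    module
  have hsin := sin_pos_of_mem_Ioo hτ
  have hreverse : 0 < -tangentLength f (φ + τ) (-τ) := by
    rw [tangentLength, sin_neg, div_neg, neg_neg]
    refine div_pos (supportGap_pos hf hpos _ (neg_ne_zero.2 hτ.1.ne') ?_) hsin
    rw [abs_neg, abs_of_pos hτ.1]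
    exact hτ.2.le
  rw [EuclideanGeometry.angle, vsub_eq_sub, vsub_eq_sub, hsub φ τ, ← tangentMeet_reverse φ hsin.ne',
    hsub (φ + τ) (-τ), InnerProductGeometry.angle_smul_right_of_pos _ _ hreverse, neg_smul,
    ← smul_neg, InnerProductGeometry.angle_smul_left_of_pos _ _ (tangentLength_pos hf hpos φ hτ),
    InnerProductGeometry.angle_neg_left, InnerProductGeometry.angle, norm_dirT, norm_dirT,
    inner_dirT_dirT, add_sub_cancel_left, mul_one, div_one, arccos_cos hτ.1.le hτ.2.le]

theorem visualAngle_tangentMeet (hK : IsStrictlyConvexC2 K) (φ : ℝ) (hτ : τ ∈ Ioo 0 π) :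
    visualAngle K (tangentMeet (supportFun K) (φ, τ)) = π - τ := by
  have hangle := angle_envelope_tangentMeet hK.contDiff hK.radius_pos φ hτ
  have hmem := envelope_mem hK.nonempty hK.isCompact hK.contDiff
  have hnotMem : tangentMeet (supportFun K) (φ, τ) ∉ K :=
    tangentPoint_notMem hK _ (tangentLength_pos hK.contDiff hK.radius_pos φ hτ)
  have hself (θ : ℝ) : EuclideanGeometry.angle (envelope (supportFun K) θ)
      (tangentMeet (supportFun K) (φ, τ)) (envelope (supportFun K) θ) = 0 :=
    EuclideanGeometry.angle_self_of_ne fun h => hnotMem (h ▸ hmem θ)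
  rw [visualAngle, tangencyPoints_tangentMeet hK φ hτ]
  refine IsGreatest.csSup_eq ⟨⟨_, Or.inl rfl, _, Or.inr rfl, hangle.symm⟩, ?_⟩
  rintro _ ⟨x, rfl | rfl, y, rfl | rfl, rfl⟩
  · exact (hself _).trans_le (sub_nonneg.2 hτ.2.le)
  · exact hangle.le
  · exact (EuclideanGeometry.angle_comm _ _ _).trans_le hangle.le
  · exact (hself _).trans_le (sub_nonneg.2 hτ.2.le)

/-! ### Change of variables -/

/-- The plane as a product of two lines. -/
def planeEquiv : ℝ × ℝ ≃ᵐ Plane :=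
  MeasurableEquiv.finTwoArrow.symm.trans (MeasurableEquiv.toLp 2 (Fin 2 → ℝ))

theorem planeEquiv_symm_apply (v : Plane) : planeEquiv.symm v = (v 0, v 1) := rfl

theorem measurePreserving_planeEquiv : MeasurePreserving planeEquiv volume volume :=
  (PiLp.volume_preserving_toLp (Fin 2)).comp (volume_preserving_finTwoArrow ℝ).symm

theorem preimage_planeEquiv_image (g : ℝ × ℝ → Plane) (s : Set (ℝ × ℝ)) :
    planeEquiv ⁻¹' (g '' s) = (fun x => planeEquiv.symm (g x)) '' s := by
  rw [← planeEquiv.image_symm, image_image]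

section PlaneImage

variable {E : Type*} [NormedAddCommGroup E] [NormedSpace ℝ E] {g : ℝ × ℝ → Plane}
  {g' : ℝ × ℝ → ℝ × ℝ →L[ℝ] ℝ × ℝ} {s : Set (ℝ × ℝ)}

theorem integrableOn_image_plane_iff (hs : MeasurableSet s)
    (hg : ∀ x ∈ s, HasFDerivWithinAt (fun x => planeEquiv.symm (g x)) (g' x) s x)
    (hinj : InjOn g s) (G : Plane → E) :
    IntegrableOn G (g '' s) ↔ IntegrableOn (fun x => |(g' x).det| • G (g x)) s := by
  rw [← measurePreserving_planeEquiv.integrableOn_comp_preimage planeEquiv.measurableEmbedding,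
    preimage_planeEquiv_image, integrableOn_image_iff_integrableOn_abs_det_fderiv_smul volume hs hg
      (planeEquiv.symm.injective.comp_injOn hinj)]
  simp only [Function.comp_apply, MeasurableEquiv.apply_symm_apply]

theorem integral_image_plane (hs : MeasurableSet s)
    (hg : ∀ x ∈ s, HasFDerivWithinAt (fun x => planeEquiv.symm (g x)) (g' x) s x)
    (hinj : InjOn g s) (G : Plane → E) :
    ∫ P in g '' s, G P = ∫ x in s, |(g' x).det| • G (g x) := by
  rw [← measurePreserving_planeEquiv.setIntegral_preimage_emb planeEquiv.measurableEmbedding,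
    preimage_planeEquiv_image, integral_image_eq_integral_abs_det_fderiv_smul volume hs hg
      (planeEquiv.symm.injective.comp_injOn hinj)]
  simp only [MeasurableEquiv.apply_symm_apply]

end PlaneImage

theorem planeEquiv_symm_tangentPoint (f : ℝ → ℝ) (φ t : ℝ) :
    planeEquiv.symm (tangentPoint f φ t) =
      (f φ * cos φ - (deriv f φ + t) * sin φ, f φ * sin φ + (deriv f φ + t) * cos φ) := by
  rw [planeEquiv_symm_apply]
  simp only [tangentPoint, envelope, PiLp.add_apply, PiLp.smul_apply, smul_eq_mul,
    dirN_apply_zero, dirN_apply_one, dirT_apply_zero, dirT_apply_one]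
  ext <;> ring

/-- The derivative at a point with first coordinate `φ` of the map
`x ↦ tangentPoint f x.1 (t x)`, read through `planeEquiv`, if `t` has partial derivatives `a` and
`b` there and `r` is the radius of curvature. -/
def tangentPointFDeriv (φ r t a b : ℝ) : ℝ × ℝ →L[ℝ] ℝ × ℝ :=
  (Matrix.toLin (.finTwoProd ℝ) (.finTwoProd ℝ)
    !![-((r + a) * sin φ) - t * cos φ, -(b * sin φ);
      (r + a) * cos φ - t * sin φ, b * cos φ]).toContinuousLinearMap

theorem det_tangentPointFDeriv (φ r t a b : ℝ) : (tangentPointFDeriv φ r t a b).det = -(t * b) := by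
  simp only [tangentPointFDeriv, LinearMap.det_toContinuousLinearMap, LinearMap.det_toLin,
    Matrix.det_fin_two_of]
  linear_combination -t * b * sin_sq_add_cos_sq φ

theorem hasFDerivAt_tangentPoint (hf : ContDiff ℝ 2 f) {t : ℝ × ℝ → ℝ} {a b : ℝ} {x : ℝ × ℝ}
    (ht : HasFDerivAt t (a • ContinuousLinearMap.fst ℝ ℝ ℝ + b • ContinuousLinearMap.snd ℝ ℝ ℝ) x) :
    HasFDerivAt (fun x : ℝ × ℝ => planeEquiv.symm (tangentPoint f x.1 (t x)))
      (tangentPointFDeriv x.1 (curvatureRadius f x.1) (t x) a b) x := by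
  have hfst : HasFDerivAt (fun x : ℝ × ℝ => x.1) (ContinuousLinearMap.fst ℝ ℝ ℝ) x :=
    hasFDerivAt_fst
  have hN := (hasDerivAt_of_contDiff_two hf x.1).comp_hasFDerivAt x hfst
  have hT := ((hasDerivAt_deriv_of_contDiff_two hf x.1).comp_hasFDerivAt x hfst).add ht
  have hcos := (hasDerivAt_cos x.1).comp_hasFDerivAt x hfst
  have hsin := (hasDerivAt_sin x.1).comp_hasFDerivAt x hfst
  simp only [planeEquiv_symm_tangentPoint]
  refine (((hN.mul hcos).sub (hT.mul hsin)).prodMk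
    ((hN.mul hsin).add (hT.mul hcos))).congr_fderiv ?_
  rw [tangentPointFDeriv, Matrix.toLin_finTwoProd_toContinuousLinearMap, curvatureRadius]
  ext <;> simp <;> ring

section TangentPointImage

variable {t a b : ℝ × ℝ → ℝ} {s : Set (ℝ × ℝ)}

theorem integrableOn_image_tangentPoint_iff (hf : ContDiff ℝ 2 f) (hs : MeasurableSet s)
    (ht : ∀ x ∈ s, HasFDerivAt t
      (a x • ContinuousLinearMap.fst ℝ ℝ ℝ + b x • ContinuousLinearMap.snd ℝ ℝ ℝ) x)
    (hinj : InjOn (fun x : ℝ × ℝ => tangentPoint f x.1 (t x)) s) (G : Plane → ℝ) :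
    IntegrableOn G ((fun x : ℝ × ℝ => tangentPoint f x.1 (t x)) '' s) ↔
      IntegrableOn (fun x => |t x * b x| * G (tangentPoint f x.1 (t x))) s := by
  rw [integrableOn_image_plane_iff hs
    (fun x hx => (hasFDerivAt_tangentPoint hf (ht x hx)).hasFDerivWithinAt) hinj]
  simp only [det_tangentPointFDeriv, abs_neg, smul_eq_mul]

theorem integral_image_tangentPoint (hf : ContDiff ℝ 2 f) (hs : MeasurableSet s)
    (ht : ∀ x ∈ s, HasFDerivAt t
      (a x • ContinuousLinearMap.fst ℝ ℝ ℝ + b x • ContinuousLinearMap.snd ℝ ℝ ℝ) x)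
    (hinj : InjOn (fun x : ℝ × ℝ => tangentPoint f x.1 (t x)) s) (G : Plane → ℝ) :
    ∫ P in (fun x : ℝ × ℝ => tangentPoint f x.1 (t x)) '' s, G P =
      ∫ x in s, |t x * b x| * G (tangentPoint f x.1 (t x)) := by
  rw [integral_image_plane hs
    (fun x hx => (hasFDerivAt_tangentPoint hf (ht x hx)).hasFDerivWithinAt) hinj]
  simp only [det_tangentPointFDeriv, abs_neg, smul_eq_mul]

end TangentPointImage

/-! ### Length and area -/

theorem integral_deriv_deriv_eq_zero (hf : ContDiff ℝ 2 f) (hper : Function.Periodic f (2 * π)) :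
    ∫ φ in (0 : ℝ)..(2 * π), deriv (deriv f) φ = 0 := by
  rw [intervalIntegral.integral_eq_sub_of_hasDerivAt
    (fun φ _ => hasDerivAt_deriv_of_contDiff_two hf φ)
    ((continuous_deriv_deriv_of_contDiff_two hf).intervalIntegrable _ _)]
  simpa [sub_eq_zero] using periodic_deriv hper 0

theorem boundaryLength_eq (hK : IsStrictlyConvexC2 K) :
    boundaryLength K = ∫ φ in (0 : ℝ)..(2 * π), supportFun K φ := by
  have hspeed (φ : ℝ) : ‖deriv (envelope (supportFun K)) φ‖ =
      supportFun K φ + deriv (deriv (supportFun K)) φ := by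
    rw [(hasDerivAt_envelope hK.contDiff φ).deriv, norm_smul, norm_dirT, mul_one,
      norm_of_nonneg (hK.radius_pos φ).le]
  simp_rw [boundaryLength, hspeed]
  rw [intervalIntegral.integral_add (hK.contDiff.continuous.intervalIntegrable _ _)
    ((continuous_deriv_deriv_of_contDiff_two hK.contDiff).intervalIntegrable _ _),
    integral_deriv_deriv_eq_zero hK.contDiff (supportFun_periodic K), add_zero]

theorem integral_comp_mul_deriv_eq_zero {g : ℝ → ℝ} (hf : ContDiff ℝ 2 f) (hg : Continuous g)
    (hper : Function.Periodic f (2 * π)) :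
    ∫ φ in (0 : ℝ)..(2 * π), g (f φ) * deriv f φ = 0 := by
  have hsubst := intervalIntegral.integral_comp_mul_deriv (a := 0) (b := 2 * π)
    (fun φ _ => hasDerivAt_of_contDiff_two hf φ)
    (continuous_deriv_of_contDiff_two hf).continuousOn hg
  have hends : f (2 * π) = f 0 := by simpa using hper 0
  rwa [hends, intervalIntegral.integral_same] at hsubst

theorem volume_real_image_tangentPoint_mul (hf : ContDiff ℝ 2 f)
    (hper : Function.Periodic f (2 * π)) (hpos : ∀ x, 0 < curvatureRadius f x) {s : ℝ → ℝ}
    (hs : Differentiable ℝ s) (hs0 : ∀ φ, 0 < s φ) :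
    volume.real ((fun x : ℝ × ℝ => tangentPoint f x.1 (s x.1 * x.2)) ''
      (Ico 0 (2 * π) ×ˢ Ioo 0 1)) = 1 / 2 * ∫ φ in (0 : ℝ)..(2 * π), s φ ^ 2 := by
  have hinj : InjOn (fun x : ℝ × ℝ => tangentPoint f x.1 (s x.1 * x.2))
      (Ico 0 (2 * π) ×ˢ Ioo 0 1) := by
    rintro ⟨φ, y⟩ ⟨hφ, hy⟩ ⟨ψ, z⟩ ⟨hψ, hz⟩ h
    have hpair := tangentPoint_injOn hf hper hpos
      (mk_mem_prod hφ (mem_Ioi.2 (mul_pos (hs0 φ) hy.1)))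
      (mk_mem_prod hψ (mem_Ioi.2 (mul_pos (hs0 ψ) hz.1))) h
    simp only [Prod.mk.injEq] at hpair
    obtain ⟨rfl, hyz⟩ := hpair
    exact congrArg (Prod.mk φ) (mul_left_cancel₀ (hs0 φ).ne' hyz)
  have hderiv (x : ℝ × ℝ) : HasFDerivAt (fun x : ℝ × ℝ => s x.1 * x.2)
      ((deriv s x.1 * x.2) • ContinuousLinearMap.fst ℝ ℝ ℝ +
        s x.1 • ContinuousLinearMap.snd ℝ ℝ ℝ) x := by
    have hfst := (hs x.1).hasDerivAt.comp_hasFDerivAt x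
      (hasFDerivAt_fst (𝕜 := ℝ) (E := ℝ) (F := ℝ))
    refine (hfst.mul hasFDerivAt_snd).congr_fderiv ?_
    ext <;> simp [mul_comm]
  have hmeas : MeasurableSet (Ico 0 (2 * π) ×ˢ Ioo (0 : ℝ) 1) :=
    measurableSet_Ico.prod measurableSet_Ioo
  rw [← setIntegral_one_eq_measureReal,
    integral_image_tangentPoint hf hmeas (fun x _ => hderiv x) hinj]
  have hjac : EqOn (fun x : ℝ × ℝ => |s x.1 * x.2 * s x.1| * 1) (fun x => s x.1 ^ 2 * x.2)
      (Ico 0 (2 * π) ×ˢ Ioo 0 1) := fun x hx => by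
    simp only
    rw [abs_of_pos (mul_pos (mul_pos (hs0 _) hx.2.1) (hs0 _))]
    ring
  rw [setIntegral_congr_fun hmeas hjac, Measure.volume_eq_prod, setIntegral_prod_mul
    (fun φ => s φ ^ 2) (fun y => y), intervalIntegral.integral_of_le two_pi_pos.le,
    integral_Ico_eq_integral_Ioc, ← integral_Ioc_eq_integral_Ioo,
    ← intervalIntegral.integral_of_le (zero_le_one' ℝ), integral_id]
  ring

/-- The distance along the oriented tangent with normal angle `φ` from the point of tangency to the
circle of radius `R` about the origin. -/
def circleDistance (f : ℝ → ℝ) (R φ : ℝ) : ℝ := √(R ^ 2 - f φ ^ 2) - deriv f φ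

section CircleDistance

variable {R : ℝ}

theorem circleDistance_pos (h : f φ ^ 2 + deriv f φ ^ 2 < R ^ 2) : 0 < circleDistance f R φ :=
  sub_pos.2 (lt_sqrt_of_sq_lt (by linarith))

theorem tangentPoint_mem_ball_iff (hR : 0 < R) (h : f φ ^ 2 + deriv f φ ^ 2 < R ^ 2) (ht : 0 < t) :
    tangentPoint f φ t ∈ Metric.ball (0 : Plane) R ↔ t < circleDistance f R φ := by
  have hlower : -√(R ^ 2 - f φ ^ 2) < deriv f φ + t :=
    (neg_sqrt_lt_of_sq_lt (by linarith : deriv f φ ^ 2 < _)).trans (lt_add_of_pos_right _ ht)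
  rw [mem_ball_zero_iff, ← sq_lt_sq₀ (norm_nonneg _) hR.le, norm_sq_eq_inner_sq_add_inner_sq _ φ,
    inner_tangentPoint_dirN, inner_tangentPoint_dirT, ← lt_sub_iff_add_lt', Real.sq_lt,
    circleDistance, lt_sub_iff_add_lt']
  exact and_iff_right hlower

theorem differentiable_circleDistance (hf : ContDiff ℝ 2 f)
    (h : ∀ φ, f φ ^ 2 + deriv f φ ^ 2 < R ^ 2) :
    Differentiable ℝ (circleDistance f R) := fun φ => by
  have hradicand : R ^ 2 - f φ ^ 2 ≠ 0 := by nlinarith [h φ, sq_nonneg (deriv f φ)]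
  refine DifferentiableAt.sub (DifferentiableAt.sqrt ?_ hradicand)
    (hasDerivAt_deriv_of_contDiff_two hf φ).differentiableAt
  exact ((hasDerivAt_of_contDiff_two hf φ).differentiableAt.pow 2).const_sub _

/-- The cross term `√(R ^ 2 - f ^ 2) f'` is the derivative of a periodic function. -/
theorem integral_circleDistance_sq (hf : ContDiff ℝ 2 f) (hper : Function.Periodic f (2 * π))
    (h : ∀ φ, f φ ^ 2 + deriv f φ ^ 2 < R ^ 2) :
    ∫ φ in (0 : ℝ)..(2 * π), circleDistance f R φ ^ 2 =
      2 * π * R ^ 2 - ∫ φ in (0 : ℝ)..(2 * π), (f φ ^ 2 - deriv f φ ^ 2) := by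
  have hcross := integral_comp_mul_deriv_eq_zero (g := fun x => √(R ^ 2 - x ^ 2)) hf
    (by fun_prop) hper
  have hcont := hf.continuous
  have hcont' := continuous_deriv_of_contDiff_two hf
  have hexpand (φ : ℝ) : circleDistance f R φ ^ 2 = R ^ 2 - (f φ ^ 2 - deriv f φ ^ 2) -
      2 * (√(R ^ 2 - f φ ^ 2) * deriv f φ) := by
    have hradicand : 0 ≤ R ^ 2 - f φ ^ 2 := by nlinarith [h φ, sq_nonneg (deriv f φ)]
    rw [circleDistance]
    linear_combination sq_sqrt hradicand
  simp_rw [hexpand]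
  rw [intervalIntegral.integral_sub, intervalIntegral.integral_sub,
    intervalIntegral.integral_const_mul, hcross, intervalIntegral.integral_const]
  · simp
  all_goals exact (by fun_prop : Continuous _).intervalIntegrable _ _

theorem sq_add_deriv_sq_lt_of_subset_ball (hK : IsStrictlyConvexC2 K)
    (hKR : K ⊆ Metric.ball 0 R) (φ : ℝ) :
    supportFun K φ ^ 2 + deriv (supportFun K) φ ^ 2 < R ^ 2 := by
  have hnorm := mem_ball_zero_iff.1
    (hKR (envelope_mem hK.nonempty hK.isCompact hK.contDiff φ))
  have hsq := norm_sq_eq_inner_sq_add_inner_sq (envelope (supportFun K) φ) φ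
  rw [inner_envelope_dirN, inner_envelope_dirT] at hsq
  rw [← hsq]
  exact pow_lt_pow_left₀ hnorm (norm_nonneg _) two_ne_zero

theorem image_tangentPoint_eq_ball_diff (hK : IsStrictlyConvexC2 K) (hR : 0 < R)
    (hKR : K ⊆ Metric.ball 0 R) :
    (fun x : ℝ × ℝ => tangentPoint (supportFun K) x.1 (circleDistance (supportFun K) R x.1 * x.2))
      '' (Ico 0 (2 * π) ×ˢ Ioo 0 1) = Metric.ball 0 R \ K := by
  have hlt := sq_add_deriv_sq_lt_of_subset_ball hK hKR
  have hpos (φ : ℝ) := circleDistance_pos (hlt φ)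
  refine Subset.antisymm (image_subset_iff.2 fun x hx => ?_) ?_
  · have ht := mul_pos (hpos x.1) hx.2.1
    exact ⟨(tangentPoint_mem_ball_iff hR (hlt _) ht).2 (mul_lt_of_lt_one_right (hpos _) hx.2.2),
      tangentPoint_notMem hK _ ht⟩
  · rintro P ⟨hPR, hPK⟩
    rw [← mem_compl_iff, ← image_tangentPoint hK] at hPK
    obtain ⟨x, ⟨hφ, ht⟩, rfl⟩ := hPK
    refine ⟨(x.1, x.2 / circleDistance (supportFun K) R x.1), ⟨hφ, div_pos ht (hpos _), ?_⟩, ?_⟩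
    · exact (div_lt_one (hpos _)).2 ((tangentPoint_mem_ball_iff hR (hlt _) ht).1 hPR)
    · simp only [mul_div_cancel₀ _ (hpos x.1).ne']

end CircleDistance

theorem volume_real_eq_signedArea (hK : IsStrictlyConvexC2 K) :
    volume.real K = signedArea (supportFun K) := by
  obtain ⟨R, hR, hKR⟩ : ∃ R > 0, K ⊆ Metric.ball 0 R :=
    hK.isCompact.isBounded.subset_ball_lt 0 0
  have hper := supportFun_periodic K
  have hlt := sq_add_deriv_sq_lt_of_subset_ball hK hKR
  have harea := volume_real_image_tangentPoint_mul hK.contDiff hper hK.radius_pos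
    (differentiable_circleDistance hK.contDiff hlt) fun φ => circleDistance_pos (hlt φ)
  have hball : volume.real (Metric.ball (0 : Plane) R) = π * R ^ 2 := by
    rw [Measure.real, EuclideanSpace.volume_ball_fin_two]
    simp [hR.le, pi_pos.le, mul_comm]
  rw [image_tangentPoint_eq_ball_diff hK hR hKR,
    measureReal_sdiff hKR hK.isCompact.measurableSet, hball,
    integral_circleDistance_sq hK.contDiff hper hlt] at harea
  rw [signedArea]
  linarith

/-! ### The function of the visual angle -/

theorem hasDerivAt_angleIntegrand (ω : ℝ) : HasDerivAt angleIntegrand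
    ((1 - cos ω) * (8 * cos ω ^ 3 + 5 * cos ω ^ 2 - 7 * cos ω - 2)) ω := by
  have hmul (c : ℝ) : HasDerivAt (fun x : ℝ => c * x) c ω := by
    simpa using (hasDerivAt_id ω).const_mul c
  refine (((((hasDerivAt_id ω).sub ((hasDerivAt_sin ω).const_mul 2)).add (hmul 2).sin).sub
    ((hmul 4).sin.const_mul (1 / 4))).sub ((hasDerivAt_sin ω).pow 3)).congr_deriv ?_
  have hcos : cos (4 * ω) = 2 * cos (2 * ω) ^ 2 - 1 := by rw [← cos_two_mul]; ring_nf
  have hsin := sin_sq ω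
  rw [hcos, cos_two_mul]
  push_cast
  linear_combination -3 * cos ω * hsin

theorem abs_angleIntegrand_le {ω : ℝ} (hω : 0 ≤ ω) : |angleIntegrand ω| ≤ 22 * (ω - sin ω) := by
  have hzero : ‖angleIntegrand 0‖ ≤ 22 * (0 - sin 0) := by simp [angleIntegrand]
  have hderiv (x : ℝ) : HasDerivAt (fun x => 22 * (x - sin x)) (22 * (1 - cos x)) x :=
    ((hasDerivAt_id x).sub (hasDerivAt_sin x)).const_mul 22
  have hbound (x : ℝ) : ‖(1 - cos x) * (8 * cos x ^ 3 + 5 * cos x ^ 2 - 7 * cos x - 2)‖ ≤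
      22 * (1 - cos x) := by
    have hcos := abs_le.1 (abs_cos_le_one x)
    rw [norm_mul, norm_of_nonneg (by linarith), mul_comm]
    refine mul_le_mul_of_nonneg_right (abs_le.2 ?_) (by linarith)
    have hsq := abs_le.1 ((abs_pow (cos x) 2).trans_le
      (pow_le_one₀ (abs_nonneg _) (abs_cos_le_one x)))
    have hcube := abs_le.1 ((abs_pow (cos x) 3).trans_le
      (pow_le_one₀ (abs_nonneg _) (abs_cos_le_one x)))
    constructor <;> linarith
  exact image_norm_le_of_norm_deriv_right_le_deriv_boundary
    (fun x _ => (hasDerivAt_angleIntegrand x).continuousAt.continuousWithinAt)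
    (fun x _ => (hasDerivAt_angleIntegrand x).hasDerivWithinAt) hzero hderiv
    (fun x _ => hbound x) (right_mem_Icc.2 hω)

theorem abs_angleIntegrand_mul_le {ω : ℝ} (h0 : 0 ≤ ω) (h1 : ω ≤ π) :
    |angleIntegrand ω| * (1 + cos ω) ^ 2 ≤ 11 * π ^ 3 * sin ω ^ 3 := by
  have hsin : 0 ≤ sin (ω / 2) := sin_nonneg_of_nonneg_of_le_pi (by linarith) (by linarith)
  have hcos : 0 ≤ cos (ω / 2) := cos_nonneg_of_neg_pi_div_two_le_of_le (by linarith) (by linarith)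
  have hjordan : ω ≤ π * sin (ω / 2) := by
    have hmul := mul_le_sin (x := ω / 2) (by linarith) (by linarith)
    calc ω = π * (2 / π * (ω / 2)) := by field_simp
      _ ≤ _ := mul_le_mul_of_nonneg_left hmul pi_pos.le
  have hcube : |angleIntegrand ω| ≤ 22 * (π * sin (ω / 2)) ^ 3 := by
    calc |angleIntegrand ω| ≤ 22 * (ω - sin ω) := abs_angleIntegrand_le h0
      _ ≤ 22 * ω ^ 3 := by linarith [sin_ge_sub_cube h0, pow_nonneg h0 3]
      _ ≤ _ := by gcongr
  have hone_add : 1 + cos ω = 2 * cos (ω / 2) ^ 2 := by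
    rw [cos_sq, mul_div_cancel₀ _ two_ne_zero]
    ring
  have hdouble : sin ω = 2 * sin (ω / 2) * cos (ω / 2) := by
    rw [← sin_two_mul, mul_div_cancel₀ _ two_ne_zero]
  have hpow : cos (ω / 2) ^ 4 ≤ cos (ω / 2) ^ 3 :=
    pow_le_pow_of_le_one hcos (cos_le_one _) (by norm_num)
  rw [hone_add, hdouble]
  calc |angleIntegrand ω| * (2 * cos (ω / 2) ^ 2) ^ 2
      = |angleIntegrand ω| * (4 * cos (ω / 2) ^ 4) := by ring
    _ ≤ 22 * (π * sin (ω / 2)) ^ 3 * (4 * cos (ω / 2) ^ 3) := by gcongr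
    _ = _ := by ring

theorem abs_mul_mul_angleIntegrand_pi_sub_le {M a b : ℝ} (hτ : τ ∈ Ioo 0 π)
    (ha : |a| ≤ M * (1 - cos τ)) (hb : |b| ≤ M * (1 - cos τ)) :
    |a * b * angleIntegrand (π - τ)| ≤ M ^ 2 * (11 * π ^ 3) * sin τ ^ 3 := by
  have hangle := abs_angleIntegrand_mul_le (ω := π - τ) (by linarith [hτ.2]) (by linarith [hτ.1])
  rw [cos_pi_sub, sin_pi_sub, ← sub_eq_add_neg] at hangle
  rw [abs_mul, abs_mul]
  calc |a| * |b| * |angleIntegrand (π - τ)|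
      ≤ M * (1 - cos τ) * (M * (1 - cos τ)) * |angleIntegrand (π - τ)| := by
        gcongr
        exact (abs_nonneg _).trans ha
    _ = M ^ 2 * (|angleIntegrand (π - τ)| * (1 - cos τ) ^ 2) := by ring
    _ ≤ M ^ 2 * (11 * π ^ 3 * sin τ ^ 3) := by gcongr
    _ = _ := by ring

/-- The weight `g'(π - τ) / sin² τ`, where `g` is the function of the visual angle. -/
def angleKernel (τ : ℝ) : ℝ := 2 / (1 - cos τ) + 3 * cos τ + 4 * cos (2 * τ)

theorem one_sub_cos_pos (hτ : τ ∈ Ioo 0 π) : 0 < 1 - cos τ := by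
  simpa using cos_lt_cos_of_nonneg_of_le_pi le_rfl hτ.2.le hτ.1

theorem hasDerivAt_angleIntegrand_pi_sub (hτ : τ ∈ Ioo 0 π) :
    HasDerivAt (fun τ => angleIntegrand (π - τ)) (-(angleKernel τ * sin τ ^ 2)) τ := by
  refine ((hasDerivAt_angleIntegrand (π - τ)).comp τ
    ((hasDerivAt_id τ).const_sub π)).congr_deriv ?_
  have hne := (one_sub_cos_pos hτ).ne'
  rw [cos_pi_sub, angleKernel, sin_sq, cos_two_mul]
  field_simp
  ring

theorem continuousOn_angleKernel : ContinuousOn angleKernel (Ioo 0 π) :=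
  ((continuousOn_const.div (by fun_prop) fun _ hτ => (one_sub_cos_pos hτ).ne').add
    (by fun_prop)).add (by fun_prop)

theorem abs_angleKernel_mul_le (hτ : τ ∈ Ioo 0 π) : |angleKernel τ| * (1 - cos τ) ≤ 16 := by
  have hpos := one_sub_cos_pos hτ
  have hprod : angleKernel τ * (1 - cos τ) =
      2 + (3 * cos τ + 4 * cos (2 * τ)) * (1 - cos τ) := by
    rw [angleKernel]
    field_simp
    ring
  have h1 := abs_le.1 (abs_cos_le_one τ)
  have h2 := abs_le.1 (abs_cos_le_one (2 * τ))
  have habs : |angleKernel τ| * (1 - cos τ) = |angleKernel τ * (1 - cos τ)| := by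
    rw [abs_mul, abs_of_pos hpos]
  rw [habs, hprod, abs_le]
  constructor <;> nlinarith

/-! ### The integral of the function of the visual angle -/

/-- The function of the visual angle times the Jacobian, in the coordinates `tangentMeet`. -/
def angleDensity (f : ℝ → ℝ) (x : ℝ × ℝ) : ℝ :=
  tangentLength f x.1 x.2 * (supportGap f (x.1 + x.2) (-x.2) / sin x.2 ^ 2) *
    angleIntegrand (π - x.2)

theorem exists_abs_curvatureRadius_le (hf : ContDiff ℝ 2 f)
    (hper : Function.Periodic f (2 * π)) : ∃ M, ∀ x, |curvatureRadius f x| ≤ M := by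
  obtain ⟨M, hM⟩ := ((periodic_curvatureRadius hper).isBounded_of_continuous two_pi_pos.ne'
    (continuous_curvatureRadius hf)).exists_norm_le
  exact ⟨M, fun x => hM _ (mem_range_self x)⟩

section Bounds

variable {M : ℝ}

theorem abs_supportGap_le_of_mem (hf : ContDiff ℝ 2 f) (hM : ∀ x, |curvatureRadius f x| ≤ M)
    (φ : ℝ) (hτ : τ ∈ Ioo 0 π) : |supportGap f φ τ| ≤ M * (1 - cos τ) :=
  abs_supportGap_le hf hM φ (by rw [abs_of_pos hτ.1]; exact hτ.2.le)

theorem abs_angleDensity_le (hf : ContDiff ℝ 2 f) (hM : ∀ x, |curvatureRadius f x| ≤ M) (φ : ℝ)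
    (hτ : τ ∈ Ioo 0 π) : |angleDensity f (φ, τ)| ≤ M ^ 2 * (11 * π ^ 3) := by
  have hsin := sin_pos_of_mem_Ioo hτ
  have hneg := abs_supportGap_le hf hM (φ + τ) (τ := -τ)
    (by rw [abs_neg, abs_of_pos hτ.1]; exact hτ.2.le)
  rw [cos_neg] at hneg
  have hprod := abs_mul_mul_angleIntegrand_pi_sub_le hτ (abs_supportGap_le_of_mem hf hM φ hτ) hneg
  have hdiv : angleDensity f (φ, τ) =
      supportGap f φ τ * supportGap f (φ + τ) (-τ) * angleIntegrand (π - τ) / sin τ ^ 3 := by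
    rw [angleDensity, tangentLength]
    field_simp
  rwa [hdiv, abs_div, abs_of_pos (pow_pos hsin 3), div_le_iff₀ (pow_pos hsin 3)]

theorem abs_angleIntegrand_mul_tangentLength_sq_le (hf : ContDiff ℝ 2 f)
    (hM : ∀ x, |curvatureRadius f x| ≤ M) (φ : ℝ) (hτ : τ ∈ Ioo 0 π) :
    |angleIntegrand (π - τ) * tangentLength f φ τ ^ 2| ≤ M ^ 2 * (11 * π ^ 3) * sin τ := by
  have hsin := sin_pos_of_mem_Ioo hτ
  have hgap := abs_supportGap_le_of_mem hf hM φ hτ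
  have hprod := abs_mul_mul_angleIntegrand_pi_sub_le hτ hgap hgap
  have hdiv : angleIntegrand (π - τ) * tangentLength f φ τ ^ 2 =
      supportGap f φ τ * supportGap f φ τ * angleIntegrand (π - τ) / sin τ ^ 2 := by
    rw [tangentLength]
    field_simp
  rw [hdiv, abs_div, abs_of_pos (pow_pos hsin 2), div_le_iff₀ (pow_pos hsin 2)]
  linarith

theorem abs_angleKernel_mul_supportGap_sq_le (hf : ContDiff ℝ 2 f)
    (hM : ∀ x, |curvatureRadius f x| ≤ M) (φ : ℝ) (hτ : τ ∈ Ioo 0 π) :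
    |angleKernel τ * supportGap f φ τ ^ 2| ≤ 32 * M ^ 2 := by
  have hpos := one_sub_cos_pos hτ
  rw [abs_mul, abs_pow]
  calc |angleKernel τ| * |supportGap f φ τ| ^ 2
      ≤ |angleKernel τ| * (M * (1 - cos τ)) ^ 2 := by
        gcongr
        exact abs_supportGap_le_of_mem hf hM φ hτ
    _ = |angleKernel τ| * (1 - cos τ) * (M ^ 2 * (1 - cos τ)) := by ring
    _ ≤ 16 * (M ^ 2 * 2) := by
        gcongr
        · exact abs_angleKernel_mul_le hτ
        · linarith [neg_one_le_cos τ]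
    _ = _ := by ring

end Bounds

theorem continuousOn_angleDensity (hf : ContDiff ℝ 2 f) :
    ContinuousOn (angleDensity f) (univ ×ˢ Ioo 0 π) := by
  have hgap := continuous_supportGap hf
  have hreverse : Continuous fun x : ℝ × ℝ => supportGap f (x.1 + x.2) (-x.2) :=
    hgap.comp (by fun_prop : Continuous fun x : ℝ × ℝ => (x.1 + x.2, -x.2))
  have hsin : ∀ x ∈ (univ ×ˢ Ioo 0 π : Set (ℝ × ℝ)), sin x.2 ≠ 0 :=
    fun x hx => (sin_pos_of_mem_Ioo hx.2).ne'
  unfold angleDensity tangentLength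
  refine ((hgap.continuousOn.div (by fun_prop) hsin).mul (hreverse.continuousOn.div (by fun_prop)
    fun x hx => pow_ne_zero 2 (hsin x hx))).mul ?_
  unfold angleIntegrand
  fun_prop

theorem continuousOn_angleKernel_mul_supportGap_sq (hf : ContDiff ℝ 2 f) :
    ContinuousOn (fun x : ℝ × ℝ => angleKernel x.2 * supportGap f x.1 x.2 ^ 2)
      (univ ×ˢ Ioo 0 π) :=
  (continuousOn_angleKernel.comp continuousOn_snd fun _ hx => hx.2).mul
    ((continuous_supportGap hf).pow 2).continuousOn

section StripIntegrable

variable {G : ℝ × ℝ → ℝ} {C : ℝ}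

theorem integrableOn_section_of_bound (hG : ContinuousOn G (univ ×ˢ Ioo 0 π)) (φ : ℝ)
    (hC : ∀ τ ∈ Ioo 0 π, |G (φ, τ)| ≤ C) : IntegrableOn (fun τ => G (φ, τ)) (Ioo 0 π) :=
  .of_bound measure_Ioo_lt_top
    ((hG.comp (by fun_prop) fun _ hτ => ⟨mem_univ _, hτ⟩).aestronglyMeasurable measurableSet_Ioo)
    C (ae_restrict_of_forall_mem measurableSet_Ioo hC)

theorem integrableOn_Ico_prod_Ioo_of_bound (hG : ContinuousOn G (univ ×ˢ Ioo 0 π))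
    (hC : ∀ φ, ∀ τ ∈ Ioo 0 π, |G (φ, τ)| ≤ C) :
    IntegrableOn G (Ico 0 (2 * π) ×ˢ Ioo 0 π) := by
  have hs : MeasurableSet (Ico 0 (2 * π) ×ˢ Ioo 0 π : Set (ℝ × ℝ)) :=
    measurableSet_Ico.prod measurableSet_Ioo
  refine .of_bound ?_ ((hG.mono (prod_mono_left (subset_univ _))).aestronglyMeasurable hs) C
    (ae_restrict_of_forall_mem hs fun x hx => hC x.1 x.2 hx.2)
  rw [Measure.volume_eq_prod, Measure.prod_prod]
  exact ENNReal.mul_lt_top measure_Ico_lt_top measure_Ioo_lt_top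

end StripIntegrable

theorem integrableOn_angleDensity (hf : ContDiff ℝ 2 f) (hper : Function.Periodic f (2 * π)) :
    IntegrableOn (angleDensity f) (Ico 0 (2 * π) ×ˢ Ioo 0 π) := by
  obtain ⟨M, hM⟩ := exists_abs_curvatureRadius_le hf hper
  exact integrableOn_Ico_prod_Ioo_of_bound (continuousOn_angleDensity hf)
    fun φ _ hτ => abs_angleDensity_le hf hM φ hτ

theorem integrableOn_angleKernel_mul_supportGap_sq (hf : ContDiff ℝ 2 f)
    (hper : Function.Periodic f (2 * π)) :
    IntegrableOn (fun x : ℝ × ℝ => angleKernel x.2 * supportGap f x.1 x.2 ^ 2)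
      (Ico 0 (2 * π) ×ˢ Ioo 0 π) := by
  obtain ⟨M, hM⟩ := exists_abs_curvatureRadius_le hf hper
  exact integrableOn_Ico_prod_Ioo_of_bound (continuousOn_angleKernel_mul_supportGap_sq hf)
    fun φ _ hτ => abs_angleKernel_mul_supportGap_sq_le hf hM φ hτ

theorem hasDerivAt_angleIntegrand_mul_tangentLength_sq (hf : ContDiff ℝ 2 f) (φ : ℝ)
    (hτ : τ ∈ Ioo 0 π) :
    HasDerivAt (fun τ => angleIntegrand (π - τ) * tangentLength f φ τ ^ 2)
      (2 * angleDensity f (φ, τ) - angleKernel τ * supportGap f φ τ ^ 2) τ := by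
  have hsin := (sin_pos_of_mem_Ioo hτ).ne'
  refine ((hasDerivAt_angleIntegrand_pi_sub hτ).mul
    ((hasDerivAt_tangentLength hf φ hsin).pow 2)).congr_deriv ?_
  simp only [angleDensity, tangentLength, Nat.cast_ofNat, Nat.add_one_sub_one, pow_one,
    Pi.pow_apply]
  field_simp
  ring

theorem tendsto_angleIntegrand_mul_tangentLength_sq (hf : ContDiff ℝ 2 f)
    (hper : Function.Periodic f (2 * π)) (φ : ℝ) {l : Filter ℝ} (hl : Ioo 0 π ∈ l)
    (hsin : Tendsto sin l (𝓝 0)) :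
    Tendsto (fun τ => angleIntegrand (π - τ) * tangentLength f φ τ ^ 2) l (𝓝 0) := by
  obtain ⟨M, hM⟩ := exists_abs_curvatureRadius_le hf hper
  refine squeeze_zero_norm' (mem_of_superset hl fun τ hτ =>
    abs_angleIntegrand_mul_tangentLength_sq_le hf hM φ hτ) ?_
  simpa using hsin.const_mul (M ^ 2 * (11 * π ^ 3))

theorem integral_angleDensity (hf : ContDiff ℝ 2 f) (hper : Function.Periodic f (2 * π)) (φ : ℝ) :
    ∫ τ in Ioo 0 π, angleDensity f (φ, τ) =
      1 / 2 * ∫ τ in Ioo 0 π, angleKernel τ * supportGap f φ τ ^ 2 := by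
  obtain ⟨M, hM⟩ := exists_abs_curvatureRadius_le hf hper
  have hdensity := integrableOn_section_of_bound (continuousOn_angleDensity hf) φ
    fun τ hτ => abs_angleDensity_le hf hM φ hτ
  have hkernel := integrableOn_section_of_bound (continuousOn_angleKernel_mul_supportGap_sq hf) φ
    fun τ hτ => abs_angleKernel_mul_supportGap_sq_le hf hM φ hτ
  have hsin_zero : Tendsto sin (𝓝[>] 0) (𝓝 0) := by
    simpa using (continuous_sin.tendsto 0).mono_left (nhdsWithin_le_nhds (s := Ioi 0))
  have hsin_pi : Tendsto sin (𝓝[<] π) (𝓝 0) := by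
    simpa using (continuous_sin.tendsto π).mono_left (nhdsWithin_le_nhds (s := Iio π))
  have hftc := intervalIntegral.integral_eq_sub_of_hasDerivAt_of_tendsto pi_pos
    (fun τ hτ => hasDerivAt_angleIntegrand_mul_tangentLength_sq hf φ hτ)
    ((intervalIntegrable_iff_integrableOn_Ioo_of_le pi_pos.le).2
      ((hdensity.const_mul 2).sub hkernel))
    (tendsto_angleIntegrand_mul_tangentLength_sq hf hper φ (Ioo_mem_nhdsGT pi_pos) hsin_zero)
    (tendsto_angleIntegrand_mul_tangentLength_sq hf hper φ (Ioo_mem_nhdsLT pi_pos) hsin_pi)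
  rw [intervalIntegral.integral_of_le pi_pos.le, integral_Ioc_eq_integral_Ioo, sub_self,
    integral_sub (hdensity.const_mul 2) hkernel, integral_const_mul] at hftc
  linarith

theorem integral_integral_angleDensity (hf : ContDiff ℝ 2 f)
    (hper : Function.Periodic f (2 * π)) :
    ∫ x in Ico 0 (2 * π) ×ˢ Ioo 0 π, angleDensity f x =
      1 / 2 * ∫ τ in Ioo 0 π, angleKernel τ *
        ∫ φ in (0 : ℝ)..(2 * π), supportGap f φ τ ^ 2 := by
  have hint := integrableOn_angleKernel_mul_supportGap_sq hf hper
  rw [IntegrableOn, Measure.volume_eq_prod, ← Measure.prod_restrict] at hint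
  rw [Measure.volume_eq_prod, setIntegral_prod _ (integrableOn_angleDensity hf hper)]
  simp_rw [integral_angleDensity hf hper]
  rw [integral_const_mul, integral_integral_swap hint]
  simp_rw [integral_const_mul, intervalIntegral.integral_of_le two_pi_pos.le,
    integral_Ico_eq_integral_Ioc]

theorem abs_jacobian_mul_angleIntegrand_visualAngle (hK : IsStrictlyConvexC2 K) {x : ℝ × ℝ}
    (hx : x.2 ∈ Ioo 0 π) :
    |tangentLength (supportFun K) x.1 x.2 *
        (supportGap (supportFun K) (x.1 + x.2) (-x.2) / sin x.2 ^ 2)| *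
      angleIntegrand (visualAngle K (tangentMeet (supportFun K) x)) =
      angleDensity (supportFun K) x := by
  have hgap := supportGap_pos hK.contDiff hK.radius_pos (x.1 + x.2) (neg_ne_zero.2 hx.1.ne')
    (by rw [abs_neg, abs_of_pos hx.1]; exact hx.2.le)
  have hlength := tangentLength_pos hK.contDiff hK.radius_pos x.1 hx
  have hsin := sin_pos_of_mem_Ioo hx
  rw [visualAngle_tangentMeet hK x.1 hx, abs_of_pos (by positivity), angleDensity]

theorem integrableOn_and_integral_angleIntegrand_visualAngle (hK : IsStrictlyConvexC2 K) :
    IntegrableOn (fun P => angleIntegrand (visualAngle K P)) Kᶜ ∧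
      ∫ P in Kᶜ, angleIntegrand (visualAngle K P) =
        ∫ x in Ico 0 (2 * π) ×ˢ Ioo 0 π, angleDensity (supportFun K) x := by
  have hs : MeasurableSet (Ico 0 (2 * π) ×ˢ Ioo 0 π : Set (ℝ × ℝ)) :=
    measurableSet_Ico.prod measurableSet_Ioo
  choose! a ha using fun x (hx : x ∈ (Ico 0 (2 * π) ×ˢ Ioo 0 π : Set (ℝ × ℝ))) =>
    hasFDerivAt_tangentLength hK.contDiff (sin_pos_of_mem_Ioo hx.2).ne'
  have hinj := tangentMeet_injOn hK.contDiff (supportFun_periodic K) hK.radius_pos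
  have hdensity : EqOn _ (angleDensity (supportFun K)) (Ico 0 (2 * π) ×ˢ Ioo 0 π) :=
    fun x hx => abs_jacobian_mul_angleIntegrand_visualAngle hK hx.2
  rw [← image_tangentMeet hK]
  constructor
  · exact ((integrableOn_image_tangentPoint_iff hK.contDiff hs ha hinj _).trans
      (integrableOn_congr_fun hdensity hs)).2
        (integrableOn_angleDensity hK.contDiff (supportFun_periodic K))
  · exact (integral_image_tangentPoint hK.contDiff hs ha hinj _).trans
      (setIntegral_congr_fun hs hdensity)

theorem integrableOn_angleIntegrand_visualAngle (hK : IsStrictlyConvexC2 K) :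
    IntegrableOn (fun P => angleIntegrand (visualAngle K P)) Kᶜ :=
  (integrableOn_and_integral_angleIntegrand_visualAngle hK).1

theorem integral_angleIntegrand_visualAngle (hK : IsStrictlyConvexC2 K) :
    ∫ P in Kᶜ, angleIntegrand (visualAngle K P) =
      1 / 2 * ∫ τ in Ioo 0 π, angleKernel τ *
        ∫ φ in (0 : ℝ)..(2 * π), supportGap (supportFun K) φ τ ^ 2 :=
  (integrableOn_and_integral_angleIntegrand_visualAngle hK).2.trans
    (integral_integral_angleDensity hK.contDiff (supportFun_periodic K))

/-! ### Fourier coefficients -/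

/-- The `n`-th complex Fourier coefficient of a real function of period `2π`. -/
def realFourierCoeff (f : ℝ → ℝ) (n : ℤ) : ℂ := fourierCoeffOn two_pi_pos (fun x => (f x : ℂ)) n

section FourierCoeff

variable {f' g : ℝ → ℝ} {n : ℤ}

theorem realFourierCoeff_eq_integral (f : ℝ → ℝ) (n : ℤ) :
    realFourierCoeff f n =
      1 / (2 * π) * ∫ x in (0 : ℝ)..(2 * π), Complex.exp (-(n * x * Complex.I)) * f x := by
  have hpi : (π : ℂ) ≠ 0 := by exact_mod_cast pi_ne_zero
  rw [realFourierCoeff, fourierCoeffOn_eq_integral, sub_zero, Complex.real_smul]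
  congr 1
  · push_cast
    rfl
  · refine intervalIntegral.integral_congr fun x _ => ?_
    simp only [smul_eq_mul]
    rw [fourier_coe_apply]
    congr 2
    push_cast
    field_simp

theorem realFourierCoeff_zero (f : ℝ → ℝ) :
    realFourierCoeff f 0 = ((1 / (2 * π) * ∫ x in (0 : ℝ)..(2 * π), f x : ℝ) : ℂ) := by
  simp [realFourierCoeff_eq_integral, intervalIntegral.integral_ofReal]

theorem hasSum_norm_realFourierCoeff_sq (hf : Continuous f) :
    HasSum (fun n => ‖realFourierCoeff f n‖ ^ 2)
      ((2 * π)⁻¹ * ∫ x in (0 : ℝ)..(2 * π), f x ^ 2) := by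
  have hcont : Continuous fun x => (f x : ℂ) := by fun_prop
  have hL2 : MemLp (fun x => (f x : ℂ)) 2 (volume.restrict (Ioc 0 (2 * π))) :=
    (memLp_two_iff_integrable_sq_norm hcont.aestronglyMeasurable).2
      ((by fun_prop : Continuous fun x => ‖(f x : ℂ)‖ ^ 2).integrableOn_Ioc)
  simpa [realFourierCoeff] using hasSum_sq_fourierCoeffOn two_pi_pos hL2

theorem realFourierCoeff_add (hf : Continuous f) (hg : Continuous g) (n : ℤ) :
    realFourierCoeff (fun x => f x + g x) n = realFourierCoeff f n + realFourierCoeff g n := by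
  simp only [realFourierCoeff_eq_integral, Complex.ofReal_add, mul_add]
  rw [intervalIntegral.integral_add ((by fun_prop : Continuous _).intervalIntegrable _ _)
    ((by fun_prop : Continuous _).intervalIntegrable _ _), mul_add]

theorem realFourierCoeff_mul_const (f : ℝ → ℝ) (c : ℝ) (n : ℤ) :
    realFourierCoeff (fun x => f x * c) n = realFourierCoeff f n * c := by
  simpa only [realFourierCoeff, Complex.ofReal_mul, mul_comm _ (c : ℂ)] using
    fourierCoeffOn.const_mul (fun x => (f x : ℂ)) c n two_pi_pos

theorem realFourierCoeff_sub (hf : Continuous f) (hg : Continuous g) (n : ℤ) :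
    realFourierCoeff (fun x => f x - g x) n = realFourierCoeff f n - realFourierCoeff g n := by
  have h := realFourierCoeff_add hf (g := fun x => g x * (-1)) (by fun_prop) n
  rw [realFourierCoeff_mul_const] at h
  simpa [sub_eq_add_neg] using h

theorem realFourierCoeff_deriv (hf : ∀ x, HasDerivAt f (f' x) x) (hf' : Continuous f')
    (hper : Function.Periodic f (2 * π)) (n : ℤ) :
    realFourierCoeff f' n = n * Complex.I * realFourierCoeff f n := by
  have hends : f (2 * π) = f 0 := by simpa using hper 0
  rcases eq_or_ne n 0 with rfl | hn
  · rw [realFourierCoeff_zero, intervalIntegral.integral_eq_sub_of_hasDerivAt (fun x _ => hf x)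
      (hf'.intervalIntegrable _ _), hends]
    simp
  · have hpi : (π : ℂ) ≠ 0 := by exact_mod_cast pi_ne_zero
    have hn' : (n : ℂ) ≠ 0 := by exact_mod_cast hn
    have hparts := fourierCoeffOn_of_hasDerivAt two_pi_pos hn (fun x _ => (hf x).ofReal_comp)
      ((by fun_prop : Continuous fun x => (f' x : ℂ)).intervalIntegrable _ _)
    rw [hends, sub_self, mul_zero, zero_sub] at hparts
    simp only [realFourierCoeff, hparts]
    push_cast
    field_simp
    ring

theorem realFourierCoeff_comp_add (hper : Function.Periodic f (2 * π)) (τ : ℝ) (n : ℤ) :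
    realFourierCoeff (fun x => f (x + τ)) n =
      Complex.exp (n * τ * Complex.I) * realFourierCoeff f n := by
  let G : ℝ → ℂ := fun x => Complex.exp (-(n * x * Complex.I)) * f x
  have hG : Function.Periodic G (2 * π) := fun x => by
    simp only [G, hper x]
    congr 1
    rw [Complex.exp_eq_exp_iff_exists_int]
    exact ⟨-n, by push_cast; ring⟩
  have hshift (x : ℝ) : Complex.exp (-(n * x * Complex.I)) * (f (x + τ) : ℂ) =
      Complex.exp (n * τ * Complex.I) * G (x + τ) := by
    simp only [G]
    rw [← mul_assoc, ← Complex.exp_add]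
    congr 2
    push_cast
    ring
  simp only [realFourierCoeff_eq_integral, hshift]
  rw [intervalIntegral.integral_const_mul, intervalIntegral.integral_comp_add_right (fun x => G x),
    zero_add, add_comm (2 * π) τ, hG.intervalIntegral_add_eq τ 0, zero_add]
  ring

theorem realFourierCoeff_eq_zero_of_deriv_deriv {k : ℝ} (hf : ∀ x, HasDerivAt f (f' x) x)
    (hf' : ∀ x, HasDerivAt f' (-k ^ 2 * f x) x) (hper : Function.Periodic f (2 * π))
    (hper' : Function.Periodic f' (2 * π)) (hn : (n : ℝ) ^ 2 ≠ k ^ 2) :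
    realFourierCoeff f n = 0 := by
  have hcont : Continuous f := continuous_iff_continuousAt.2 fun x => (hf x).continuousAt
  have hcont' : Continuous f' := continuous_iff_continuousAt.2 fun x => (hf' x).continuousAt
  have hscale := realFourierCoeff_mul_const f (-k ^ 2) n
  simp_rw [mul_comm _ (-k ^ 2)] at hscale
  have hderiv := realFourierCoeff_deriv hf' (by fun_prop) hper' n
  rw [hscale, realFourierCoeff_deriv hf hcont' hper n] at hderiv
  have hprod : (((n : ℝ) ^ 2 - k ^ 2 : ℝ) : ℂ) * realFourierCoeff f n = 0 := by
    push_cast at hderiv ⊢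
    linear_combination hderiv + n ^ 2 * realFourierCoeff f n * Complex.I_sq
  exact (mul_eq_zero.1 hprod).resolve_left
    fun h => hn (sub_eq_zero.1 (Complex.ofReal_eq_zero.1 h))

theorem realFourierCoeff_const (c : ℝ) (hn : n ≠ 0) : realFourierCoeff (fun _ => c) n = 0 :=
  realFourierCoeff_eq_zero_of_deriv_deriv (f' := fun _ => 0) (k := 0)
    (fun x => hasDerivAt_const x c) (fun x => by simpa using hasDerivAt_const x (0 : ℝ))
    (fun _ => rfl) (fun _ => rfl) (by simpa using hn)

theorem realFourierCoeff_eq_zero_of_add_comp_add_pi {w : ℝ} (hf : Continuous f)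
    (hper : Function.Periodic f (2 * π)) (hw : ∀ x, f x + f (x + π) = w) (hn : Even n)
    (hn0 : n ≠ 0) : realFourierCoeff f n = 0 := by
  have hsum := realFourierCoeff_add hf (g := fun x => f (x + π)) (by fun_prop) n
  have hexp : Complex.exp (n * π * Complex.I) = 1 := by
    obtain ⟨m, rfl⟩ := hn
    rw [Complex.exp_eq_one_iff]
    exact ⟨m, by push_cast; ring⟩
  simp_rw [hw] at hsum
  rw [realFourierCoeff_const w hn0, realFourierCoeff_comp_add hper, hexp] at hsum
  linear_combination -1 / 2 * hsum

end FourierCoeff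

/-- The square modulus of the factor by which `f ↦ supportGap f · τ` multiplies the `n`-th Fourier
coefficient. -/
def gapMultiplier (n : ℤ) (τ : ℝ) : ℝ :=
  (cos (n * τ) - cos τ) ^ 2 + (sin (n * τ) - n * sin τ) ^ 2

theorem norm_realFourierCoeff_supportGap_sq (hf : ContDiff ℝ 2 f)
    (hper : Function.Periodic f (2 * π)) (τ : ℝ) (n : ℤ) :
    ‖realFourierCoeff (fun φ => supportGap f φ τ) n‖ ^ 2 =
      gapMultiplier n τ * ‖realFourierCoeff f n‖ ^ 2 := by
  have hcont := hf.continuous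
  have hcont' := continuous_deriv_of_contDiff_two hf
  have hfactor : realFourierCoeff (fun φ => supportGap f φ τ) n =
      ((cos (n * τ) - cos τ : ℝ) + (sin (n * τ) - n * sin τ : ℝ) * Complex.I) *
        realFourierCoeff f n := by
    unfold supportGap
    rw [realFourierCoeff_sub (by fun_prop) (by fun_prop),
      realFourierCoeff_sub (by fun_prop) (by fun_prop), realFourierCoeff_comp_add hper,
      realFourierCoeff_mul_const, realFourierCoeff_mul_const,
      realFourierCoeff_deriv (hasDerivAt_of_contDiff_two hf) hcont' hper, Complex.exp_mul_I]
    push_cast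
    ring
  rw [hfactor, norm_mul, mul_pow, ← Complex.normSq_eq_norm_sq (_ + _), Complex.normSq_add_mul_I]
  rfl

theorem hasSum_supportGap_sq (hf : ContDiff ℝ 2 f) (hper : Function.Periodic f (2 * π)) (τ : ℝ) :
    HasSum (fun n => gapMultiplier n τ * ‖realFourierCoeff f n‖ ^ 2)
      ((2 * π)⁻¹ * ∫ φ in (0 : ℝ)..(2 * π), supportGap f φ τ ^ 2) := by
  have hcont : Continuous fun φ => supportGap f φ τ :=
    (continuous_supportGap hf).comp (by fun_prop : Continuous fun φ : ℝ => (φ, τ))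
  simpa only [norm_realFourierCoeff_supportGap_sq hf hper] using
    hasSum_norm_realFourierCoeff_sq hcont

theorem hasSum_deriv_sq (hf : ContDiff ℝ 2 f) (hper : Function.Periodic f (2 * π)) :
    HasSum (fun n : ℤ => (n : ℝ) ^ 2 * ‖realFourierCoeff f n‖ ^ 2)
      ((2 * π)⁻¹ * ∫ φ in (0 : ℝ)..(2 * π), deriv f φ ^ 2) := by
  have hcont' := continuous_deriv_of_contDiff_two hf
  refine (hasSum_norm_realFourierCoeff_sq hcont').congr_fun fun n => ?_
  rw [realFourierCoeff_deriv (hasDerivAt_of_contDiff_two hf) hcont' hper]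
  simp [mul_pow]

theorem hasSum_deriv_deriv_sq (hf : ContDiff ℝ 2 f) (hper : Function.Periodic f (2 * π)) :
    HasSum (fun n : ℤ => (n : ℝ) ^ 4 * ‖realFourierCoeff f n‖ ^ 2)
      ((2 * π)⁻¹ * ∫ φ in (0 : ℝ)..(2 * π), deriv (deriv f) φ ^ 2) := by
  have hcont' := continuous_deriv_of_contDiff_two hf
  have hcont'' := continuous_deriv_deriv_of_contDiff_two hf
  refine (hasSum_norm_realFourierCoeff_sq hcont'').congr_fun fun n => ?_
  rw [realFourierCoeff_deriv (hasDerivAt_deriv_of_contDiff_two hf) hcont'' (periodic_deriv hper),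
    realFourierCoeff_deriv (hasDerivAt_of_contDiff_two hf) hcont' hper]
  simp only [norm_mul, Complex.norm_intCast, Complex.norm_I, mul_one, mul_pow, sq_abs]
  ring

/-! ### Integrals of the multipliers -/

theorem integral_Ioo_cos_int_mul (k : ℤ) :
    ∫ τ in Ioo 0 π, cos (k * τ) = if k = 0 then π else 0 := by
  rw [← integral_Ioc_eq_integral_Ioo, ← intervalIntegral.integral_of_le pi_nonneg]
  split_ifs with h
  · simp [h]
  · rw [intervalIntegral.integral_comp_mul_left (fun x => cos x) (by exact_mod_cast h),
      integral_cos]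
    simp [sin_int_mul_pi]

theorem integral_Ioo_cos_mul_cos {j : ℤ} (hj : 0 < j) (k : ℤ) :
    ∫ τ in Ioo 0 π, cos (j * τ) * cos (k * τ) = if |k| = j then π / 2 else 0 := by
  have hcos (i : ℤ) : IntegrableOn (fun τ => cos (i * τ)) (Ioo 0 π) :=
    (by fun_prop : Continuous _).integrableOn_Icc.mono_set Ioo_subset_Icc_self
  have hprod (τ : ℝ) : cos (j * τ) * cos (k * τ) =
      1 / 2 * (cos ((j - k : ℤ) * τ) + cos ((j + k : ℤ) * τ)) := by
    push_cast
    rw [sub_mul, add_mul, cos_sub, cos_add]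
    ring
  simp_rw [hprod]
  rw [integral_const_mul, integral_add (hcos _) (hcos _), integral_Ioo_cos_int_mul,
    integral_Ioo_cos_int_mul]
  rcases abs_cases k with ⟨hk, _⟩ | ⟨hk, _⟩ <;> rw [hk] <;> split_ifs <;> first | omega | ring

/-- The Fejér kernel, up to normalization. -/
def fejer (k : ℤ) (τ : ℝ) : ℝ := (1 - cos (k * τ)) / (1 - cos τ)

theorem fejer_neg (k : ℤ) (τ : ℝ) : fejer (-k) τ = fejer k τ := by
  simp [fejer]

theorem fejer_add_two (k : ℤ) (hτ : τ ∈ Ioo 0 π) :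
    fejer (k + 2) τ = 2 * fejer (k + 1) τ - fejer k τ + 2 * cos ((k + 1 : ℤ) * τ) := by
  have hpos := (one_sub_cos_pos hτ).ne'
  have hcos : cos (((k : ℝ) + 2) * τ) = 2 * cos τ * cos ((k + 1) * τ) - cos (k * τ) := by
    rw [show ((k : ℝ) + 2) * τ = (k + 1) * τ + τ by ring,
      show (k : ℝ) * τ = (k + 1) * τ - τ by ring, cos_add, cos_sub]
    ring
  simp only [fejer]
  push_cast
  rw [hcos]
  field_simp
  ring

theorem integrableOn_fejer_natCast_and_integral (m : ℕ) :
    IntegrableOn (fejer m) (Ioo 0 π) ∧ ∫ τ in Ioo 0 π, fejer m τ = m * π := by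
  induction m using Nat.twoStepInduction with
  | zero =>
    have h : fejer (0 : ℕ) = fun _ => 0 := funext fun τ => by simp [fejer]
    rw [h]
    simp
  | one =>
    have h : EqOn (fejer (1 : ℕ)) (fun _ => 1) (Ioo 0 π) := fun τ hτ => by
      simp [fejer, (one_sub_cos_pos hτ).ne']
    rw [integrableOn_congr_fun h measurableSet_Ioo, setIntegral_congr_fun measurableSet_Ioo h]
    simp [pi_nonneg]
  | more m ih ih' =>
    have h : EqOn (fejer (m + 2 : ℕ)) (fun τ => 2 * fejer (m + 1 : ℕ) τ - fejer m τ +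
        2 * cos ((m + 1 : ℤ) * τ)) (Ioo 0 π) := fun τ hτ => by
      exact_mod_cast fejer_add_two m hτ
    have hcos : IntegrableOn (fun τ => 2 * cos ((m + 1 : ℤ) * τ)) (Ioo 0 π) :=
      (by fun_prop : Continuous _).integrableOn_Icc.mono_set Ioo_subset_Icc_self
    have hdiff : IntegrableOn (fun τ => 2 * fejer (m + 1 : ℕ) τ - fejer m τ) (Ioo 0 π) :=
      (ih'.1.const_mul 2).sub ih.1
    rw [integrableOn_congr_fun h measurableSet_Ioo, setIntegral_congr_fun measurableSet_Ioo h]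
    refine ⟨hdiff.add hcos, ?_⟩
    rw [integral_add hdiff hcos, integral_sub (ih'.1.const_mul 2) ih.1, integral_const_mul,
      integral_const_mul, ih.2, ih'.2, integral_Ioo_cos_int_mul, if_neg (by positivity)]
    push_cast
    ring

theorem integrableOn_fejer_and_integral (k : ℤ) :
    IntegrableOn (fejer k) (Ioo 0 π) ∧ ∫ τ in Ioo 0 π, fejer k τ = |k| * π := by
  obtain ⟨m, rfl | rfl⟩ := k.eq_nat_or_neg
  · simpa using integrableOn_fejer_natCast_and_integral m
  · have h : fejer (-m : ℤ) = fejer m := funext (fejer_neg m)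
    simpa [h] using integrableOn_fejer_natCast_and_integral m

theorem integrableOn_angleKernel_mul_one_sub_cos_and_integral (k : ℤ) :
    IntegrableOn (fun τ => angleKernel τ * (1 - cos (k * τ))) (Ioo 0 π) ∧
      ∫ τ in Ioo 0 π, angleKernel τ * (1 - cos (k * τ)) =
        π * (2 * |k| - (if |k| = 1 then 3 / 2 else 0) - if |k| = 2 then 2 else 0) := by
  obtain ⟨hfejer, hfejer_int⟩ := integrableOn_fejer_and_integral k
  have hcont {g : ℝ → ℝ} (hg : Continuous g) : IntegrableOn g (Ioo 0 π) :=
    hg.integrableOn_Icc.mono_set Ioo_subset_Icc_self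
  have htrig (j : ℤ) (hj : 0 < j) : ∫ τ in Ioo 0 π, (cos (j * τ) - cos (j * τ) * cos (k * τ)) =
      -if |k| = j then π / 2 else 0 := by
    rw [integral_sub (hcont (by fun_prop)) (hcont (by fun_prop)), integral_Ioo_cos_int_mul,
      integral_Ioo_cos_mul_cos hj, if_neg hj.ne', zero_sub]
  have heq : EqOn (fun τ => angleKernel τ * (1 - cos (k * τ))) (fun τ => 2 * fejer k τ +
      (3 * (cos ((1 : ℤ) * τ) - cos ((1 : ℤ) * τ) * cos (k * τ)) +
        4 * (cos ((2 : ℤ) * τ) - cos ((2 : ℤ) * τ) * cos (k * τ)))) (Ioo 0 π) := fun τ hτ => by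
    have hpos := (one_sub_cos_pos hτ).ne'
    simp only [angleKernel, fejer, Int.cast_one, one_mul, Int.cast_ofNat]
    field_simp
    ring
  rw [integrableOn_congr_fun heq measurableSet_Ioo, setIntegral_congr_fun measurableSet_Ioo heq]
  refine ⟨(hfejer.const_mul 2).add (hcont (by fun_prop)), ?_⟩
  rw [integral_add (hfejer.const_mul 2) (hcont (by fun_prop)),
    integral_add (hcont (by fun_prop)) (hcont (by fun_prop)), integral_const_mul,
    integral_const_mul, integral_const_mul, hfejer_int, htrig 1 one_pos, htrig 2 two_pos]
  split_ifs <;> ring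

theorem gapMultiplier_eq (n : ℤ) (τ : ℝ) : gapMultiplier n τ =
    ((n : ℝ) ^ 2 - 1) / 2 * (1 - cos ((2 : ℤ) * τ)) + (n + 1) * (1 - cos ((n - 1 : ℤ) * τ)) -
      (n - 1) * (1 - cos ((n + 1 : ℤ) * τ)) := by
  simp only [gapMultiplier]
  push_cast
  rw [sub_one_mul, add_one_mul (n : ℝ) τ, cos_add, cos_sub, cos_two_mul]
  linear_combination sin_sq_add_cos_sq (n * τ) + (n : ℝ) ^ 2 * sin_sq_add_cos_sq τ

theorem angleKernel_mul_gapMultiplier (n : ℤ) (τ : ℝ) : angleKernel τ * gapMultiplier n τ =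
    ((n : ℝ) ^ 2 - 1) / 2 * (angleKernel τ * (1 - cos ((2 : ℤ) * τ))) +
      (n + 1) * (angleKernel τ * (1 - cos ((n - 1 : ℤ) * τ))) -
      (n - 1) * (angleKernel τ * (1 - cos ((n + 1 : ℤ) * τ))) := by
  rw [gapMultiplier_eq]
  ring

theorem integrableOn_angleKernel_mul_gapMultiplier (n : ℤ) :
    IntegrableOn (fun τ => angleKernel τ * gapMultiplier n τ) (Ioo 0 π) := by
  have h (k : ℤ) := (integrableOn_angleKernel_mul_one_sub_cos_and_integral k).1
  simp_rw [angleKernel_mul_gapMultiplier]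
  exact (((h 2).const_mul _).add ((h (n - 1)).const_mul _)).sub ((h (n + 1)).const_mul _)

theorem integral_angleKernel_mul_gapMultiplier_eq_combination (n : ℤ) {I : ℤ → ℝ}
    (hI : ∀ k : ℤ, ∫ τ in Ioo 0 π, angleKernel τ * (1 - cos (k * τ)) = I k) :
    ∫ τ in Ioo 0 π, angleKernel τ * gapMultiplier n τ =
      ((n : ℝ) ^ 2 - 1) / 2 * I 2 + (n + 1) * I (n - 1) - (n - 1) * I (n + 1) := by
  have h (k : ℤ) (c : ℝ) :
      IntegrableOn (fun τ => c * (angleKernel τ * (1 - cos (k * τ)))) (Ioo 0 π) :=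
    (integrableOn_angleKernel_mul_one_sub_cos_and_integral k).1.const_mul c
  simp_rw [angleKernel_mul_gapMultiplier]
  rw [integral_sub (by exact (h 2 _).add (h (n - 1) _)) (h (n + 1) _),
    integral_add (h 2 _) (h (n - 1) _), integral_const_mul, integral_const_mul,
    integral_const_mul, hI, hI, hI]

theorem integral_angleKernel_mul_gapMultiplier {n : ℤ} (hn : n = 0 ∨ Odd n) :
    ∫ τ in Ioo 0 π, angleKernel τ * gapMultiplier n τ =
      π * if 5 ≤ |n| then (n : ℝ) ^ 2 - 1 else 0 := by
  rw [integral_angleKernel_mul_gapMultiplier_eq_combination n fun k : ℤ =>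
    (integrableOn_angleKernel_mul_one_sub_cos_and_integral k).2]
  rcases le_or_gt 5 |n| with hlarge | hsmall
  · have habs : ((|n - 1| : ℤ) : ℝ) * (n + 1) = (|n + 1| : ℤ) * (n - 1) := by
      rcases le_abs'.1 hlarge with h | h
      · rw [abs_of_neg (by omega), abs_of_neg (by omega)]
        push_cast
        ring
      · rw [abs_of_pos (by omega), abs_of_pos (by omega)]
        push_cast
        ring
    have hlo : 4 ≤ |n - 1| := by grind
    have hhi : 4 ≤ |n + 1| := by grind
    rw [if_pos hlarge, if_neg (by omega : |n - 1| ≠ 1), if_neg (by omega : |n - 1| ≠ 2),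
      if_neg (by omega : |n + 1| ≠ 1), if_neg (by omega : |n + 1| ≠ 2), abs_two,
      if_neg (by norm_num), if_pos rfl]
    push_cast at habs ⊢
    linear_combination 2 * π * habs
  · rw [if_neg hsmall.not_ge]
    have hcases : n = -3 ∨ n = -1 ∨ n = 0 ∨ n = 1 ∨ n = 3 := by
      obtain ⟨hlo, hhi⟩ := abs_lt.1 hsmall
      rcases hn with rfl | ⟨m, rfl⟩ <;> omega
    rcases hcases with rfl | rfl | rfl | rfl | rfl <;> norm_num <;> ring

theorem abs_angleKernel_mul_gapMultiplier_le (n : ℤ) (hτ : τ ∈ Ioo 0 π) :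
    |angleKernel τ * gapMultiplier n τ| ≤ 64 * ((n : ℝ) ^ 2 + 1) ^ 2 := by
  have hlin (x : ℝ) : HasDerivAt (fun x : ℝ => (n : ℝ) * x) n x := by
    simpa using (hasDerivAt_id x).const_mul (n : ℝ)
  have hcos' : deriv (fun x => cos (n * x)) = fun x => -n * sin (n * x) :=
    funext fun x => by rw [(hlin x).cos.deriv]; ring
  have hsin' : deriv (fun x => sin (n * x)) = fun x => n * cos (n * x) :=
    funext fun x => by rw [(hlin x).sin.deriv]; ring
  have hcos'' (x : ℝ) : curvatureRadius (fun x => cos (n * x)) x = (1 - n ^ 2) * cos (n * x) := by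
    rw [curvatureRadius, hcos', ((hlin x).sin.const_mul (-n : ℝ)).deriv]
    ring
  have hsin'' (x : ℝ) : curvatureRadius (fun x => sin (n * x)) x = (1 - n ^ 2) * sin (n * x) := by
    rw [curvatureRadius, hsin', ((hlin x).cos.const_mul (n : ℝ)).deriv]
    ring
  have hbound {y : ℝ} (hy : |y| ≤ 1) : |(1 - (n : ℝ) ^ 2) * y| ≤ (n : ℝ) ^ 2 + 1 := by
    rw [abs_mul]
    calc |1 - (n : ℝ) ^ 2| * |y| ≤ |1 - (n : ℝ) ^ 2| * 1 := by gcongr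
      _ ≤ (n : ℝ) ^ 2 + 1 := by
        rw [mul_one, abs_le]
        constructor <;> linarith [sq_nonneg (n : ℝ)]
  have hsplit : gapMultiplier n τ = supportGap (fun x => cos (n * x)) 0 τ ^ 2 +
      supportGap (fun x => sin (n * x)) 0 τ ^ 2 := by
    simp [gapMultiplier, supportGap, hcos', hsin']
  rw [hsplit, mul_add]
  refine (abs_add_le _ _).trans ?_
  have h₁ := abs_angleKernel_mul_supportGap_sq_le (f := fun x => cos (n * x)) (by fun_prop)
    (fun x => (hcos'' x).symm ▸ hbound (abs_cos_le_one _)) 0 hτ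
  have h₂ := abs_angleKernel_mul_supportGap_sq_le (f := fun x => sin (n * x)) (by fun_prop)
    (fun x => (hsin'' x).symm ▸ hbound (abs_sin_le_one _)) 0 hτ
  linarith

/-! ### Summation over the frequencies -/

theorem summable_integral_norm_angleKernel_mul_gapMultiplier (hf : ContDiff ℝ 2 f)
    (hper : Function.Periodic f (2 * π)) : Summable fun n : ℤ => ∫ τ in Ioo 0 π,
      ‖angleKernel τ * gapMultiplier n τ * ‖realFourierCoeff f n‖ ^ 2‖ := by
  have h₀ := (hasSum_norm_realFourierCoeff_sq hf.continuous).summable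
  have h₂ := (hasSum_deriv_sq hf hper).summable
  have h₄ := (hasSum_deriv_deriv_sq hf hper).summable
  refine Summable.of_nonneg_of_le (fun n => integral_nonneg fun τ => norm_nonneg _) (fun n => ?_)
    (((h₄.add (h₂.mul_left 2)).add h₀).mul_left (64 * π))
  calc ∫ τ in Ioo 0 π, ‖angleKernel τ * gapMultiplier n τ * ‖realFourierCoeff f n‖ ^ 2‖
      ≤ ∫ τ in Ioo 0 π, 64 * ((n : ℝ) ^ 2 + 1) ^ 2 * ‖realFourierCoeff f n‖ ^ 2 := by
        refine setIntegral_mono_on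
          ((integrableOn_angleKernel_mul_gapMultiplier n).mul_const _).norm
          (integrable_const _) measurableSet_Ioo fun τ hτ => ?_
        rw [norm_mul, norm_pow, norm_norm]
        gcongr
        exact abs_angleKernel_mul_gapMultiplier_le n hτ
    _ = 64 * π * ((n : ℝ) ^ 4 * ‖realFourierCoeff f n‖ ^ 2 +
          2 * ((n : ℝ) ^ 2 * ‖realFourierCoeff f n‖ ^ 2) + ‖realFourierCoeff f n‖ ^ 2) := by
        rw [setIntegral_const]
        simp only [measureReal_def, volume_Ioo, sub_zero, ENNReal.toReal_ofReal pi_nonneg,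
          smul_eq_mul]
        ring

theorem hasSum_integral_angleKernel (hf : ContDiff ℝ 2 f) (hper : Function.Periodic f (2 * π)) :
    HasSum (fun n : ℤ => (∫ τ in Ioo 0 π, angleKernel τ * gapMultiplier n τ) *
        ‖realFourierCoeff f n‖ ^ 2)
      ((2 * π)⁻¹ * ∫ τ in Ioo 0 π, angleKernel τ *
        ∫ φ in (0 : ℝ)..(2 * π), supportGap f φ τ ^ 2) := by
  have h := hasSum_integral_of_summable_integral_norm (μ := volume.restrict (Ioo 0 π))
    (fun n => (integrableOn_angleKernel_mul_gapMultiplier n).mul_const (‖realFourierCoeff f n‖ ^ 2))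
    (summable_integral_norm_angleKernel_mul_gapMultiplier hf hper)
  simp_rw [integral_mul_const, mul_assoc, tsum_mul_left, (hasSum_supportGap_sq hf hper _).tsum_eq]
    at h
  convert! h using 1
  rw [← integral_const_mul]
  refine integral_congr_ae (.of_forall fun τ => ?_)
  ring

/-! ### Fourier series of the two sides of the inequality -/

theorem hasSum_half_integral_sub {a b : ℤ → ℝ} {u v : ℝ → ℝ} (hu : Continuous u)
    (hv : Continuous v) (ha : HasSum a ((2 * π)⁻¹ * ∫ x in (0 : ℝ)..(2 * π), u x))
    (hb : HasSum b ((2 * π)⁻¹ * ∫ x in (0 : ℝ)..(2 * π), v x)) :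
    HasSum (fun n => π * (a n - b n)) (1 / 2 * ∫ x in (0 : ℝ)..(2 * π), (u x - v x)) := by
  convert! (ha.sub hb).mul_left π using 1
  rw [intervalIntegral.integral_sub (hu.intervalIntegrable _ _) (hv.intervalIntegrable _ _)]
  field_simp

theorem hasSum_signedArea (hf : ContDiff ℝ 2 f) (hper : Function.Periodic f (2 * π)) :
    HasSum (fun n : ℤ => π * ((1 - (n : ℝ) ^ 2) * ‖realFourierCoeff f n‖ ^ 2)) (signedArea f) := by
  refine (hasSum_half_integral_sub (hf.continuous.pow 2)
    ((continuous_deriv_of_contDiff_two hf).pow 2) (hasSum_norm_realFourierCoeff_sq hf.continuous)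
    (hasSum_deriv_sq hf hper)).congr_fun fun n => ?_
  ring

theorem signedArea_evoluteSupport (hper : Function.Periodic f (2 * π)) :
    signedArea (evoluteSupport f) =
      1 / 2 * ∫ θ in (0 : ℝ)..(2 * π), (deriv f θ ^ 2 - deriv (deriv f) θ ^ 2) := by
  let G : ℝ → ℝ := fun θ => deriv f θ ^ 2 - deriv (deriv f) θ ^ 2
  have hderiv (θ : ℝ) : deriv (evoluteSupport f) θ = deriv (deriv f) (θ - π / 2) :=
    deriv_comp_sub_const (f := deriv f) (a := π / 2) (x := θ)
  have hG : Function.Periodic G (2 * π) := fun θ => by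
    simp only [G, periodic_deriv hper θ, periodic_deriv (periodic_deriv hper) θ]
  simp_rw [signedArea, hderiv]
  calc 1 / 2 * ∫ θ in (0 : ℝ)..(2 * π), G (θ - π / 2)
      = 1 / 2 * ∫ θ in (0 - π / 2)..(0 - π / 2 + 2 * π), G θ := by
        rw [intervalIntegral.integral_comp_sub_right G]
        ring_nf
    _ = 1 / 2 * ∫ θ in (0 : ℝ)..(2 * π), G θ := by
        rw [hG.intervalIntegral_add_eq _ 0, zero_add]

theorem hasSum_signedArea_evoluteSupport (hf : ContDiff ℝ 2 f)
    (hper : Function.Periodic f (2 * π)) :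
    HasSum (fun n : ℤ => π * (((n : ℝ) ^ 2 * (1 - (n : ℝ) ^ 2)) * ‖realFourierCoeff f n‖ ^ 2))
      (signedArea (evoluteSupport f)) := by
  rw [signedArea_evoluteSupport hper]
  refine (hasSum_half_integral_sub ((continuous_deriv_of_contDiff_two hf).pow 2)
    ((continuous_deriv_deriv_of_contDiff_two hf).pow 2) (hasSum_deriv_sq hf hper)
    (hasSum_deriv_deriv_sq hf hper)).congr_fun fun n => ?_
  ring

theorem signedArea_evoluteSupport_nonpos (hf : ContDiff ℝ 2 f)
    (hper : Function.Periodic f (2 * π)) : signedArea (evoluteSupport f) ≤ 0 := by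
  refine (hasSum_signedArea_evoluteSupport hf hper).nonpos fun n => ?_
  refine mul_nonpos_of_nonneg_of_nonpos pi_nonneg
    (mul_nonpos_of_nonpos_of_nonneg ?_ (sq_nonneg _))
  have hn : (0 : ℝ) ≤ (n : ℝ) ^ 2 * ((n : ℝ) ^ 2 - 1) := by
    rcases eq_or_ne n 0 with rfl | hn
    · simp
    · have : (1 : ℝ) ≤ (n : ℝ) ^ 2 := by exact_mod_cast (by positivity : 0 < n ^ 2)
      exact mul_nonneg (sq_nonneg _) (by linarith)
  linarith

theorem hasSum_isoDeficit (hK : IsStrictlyConvexC2 K) :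
    HasSum (fun n : ℤ => if n = 0 then 0 else
      4 * π ^ 2 * (((n : ℝ) ^ 2 - 1) * ‖realFourierCoeff (supportFun K) n‖ ^ 2))
      (isoDeficit K) := by
  have harea := hasSum_signedArea hK.contDiff (supportFun_periodic K)
  rw [← volume_real_eq_signedArea hK] at harea
  have hlength : boundaryLength K ^ 2 = 4 * π ^ 2 * ‖realFourierCoeff (supportFun K) 0‖ ^ 2 := by
    rw [realFourierCoeff_zero, Complex.norm_real, Real.norm_eq_abs, sq_abs, boundaryLength_eq hK]
    field_simp
    ring
  refine ((hasSum_ite_eq (0 : ℤ) (boundaryLength K ^ 2)).sub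
    (harea.mul_left (4 * π))).congr_fun fun n => ?_
  rw [hlength]
  split_ifs with hn
  · subst hn
    simp only [Int.cast_zero, ne_eq, OfNat.ofNat_ne_zero, not_false_eq_true, zero_pow, sub_zero,
      one_mul]
    ring
  · ring

/-- The contribution of the frequencies `±n` with `|n| ≥ 5` to the deficit, without the factor
`n ^ 2 - 9` coming from the left-hand side or `16` coming from the right-hand side. -/
def highEnergy (f : ℝ → ℝ) (n : ℤ) : ℝ :=
  if 5 ≤ |n| then 4 * π ^ 2 / 9 * ((n : ℝ) ^ 2 - 1) * ‖realFourierCoeff f n‖ ^ 2 else 0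

theorem sq_le_sq_of_le_abs {m n : ℤ} (hm : 0 ≤ m) (h : m ≤ |n|) : (m : ℝ) ^ 2 ≤ (n : ℝ) ^ 2 := by
  exact_mod_cast sq_le_sq.2 ((abs_of_nonneg hm).trans_le h)

theorem highEnergy_nonneg (f : ℝ → ℝ) (n : ℤ) : 0 ≤ highEnergy f n := by
  unfold highEnergy
  split_ifs with hn
  · have := sq_le_sq_of_le_abs (by norm_num) hn
    have : 0 ≤ (n : ℝ) ^ 2 - 1 := by push_cast at this; linarith
    positivity
  · exact le_rfl

theorem highEnergy_eq_zero_iff {n : ℤ} :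
    highEnergy f n = 0 ↔ (5 ≤ |n| → realFourierCoeff f n = 0) := by
  unfold highEnergy
  split_ifs with hn
  · have := sq_le_sq_of_le_abs (by norm_num) hn
    have : (n : ℝ) ^ 2 - 1 ≠ 0 := by push_cast at this; linarith
    simp [hn, this, pi_ne_zero]
  · simp [hn]

theorem realFourierCoeff_supportFun_eq_zero (hK : IsStrictlyConvexC2 K) (hw : HasConstantWidth K)
    {n : ℤ} (hn : Even n) (hn0 : n ≠ 0) : realFourierCoeff (supportFun K) n = 0 := by
  obtain ⟨w, hw⟩ := exists_supportFun_add_pi_eq hK.nonempty hK.isCompact hK.convex hw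
  exact realFourierCoeff_eq_zero_of_add_comp_add_pi hK.contDiff.continuous
    (supportFun_periodic K) hw hn hn0

theorem hasSum_widthDeficit (hK : IsStrictlyConvexC2 K) (hw : HasConstantWidth K) :
    HasSum (fun n : ℤ => ((n : ℝ) ^ 2 - 9) * highEnergy (supportFun K) n) (widthDeficit K) := by
  have hevolute := (hasSum_signedArea_evoluteSupport hK.contDiff (supportFun_periodic K)).neg
  have habs : |evoluteArea K| = -signedArea (evoluteSupport (supportFun K)) :=
    abs_of_nonpos (signedArea_evoluteSupport_nonpos hK.contDiff (supportFun_periodic K))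
  rw [← habs] at hevolute
  refine ((hevolute.mul_left (4 / 9 * π)).sub (hasSum_isoDeficit hK)).congr_fun fun n => ?_
  unfold highEnergy
  rcases eq_or_ne n 0 with rfl | hn
  · simp
  rw [if_neg hn]
  rcases Int.even_or_odd n with heven | ⟨k, rfl⟩
  · simp [realFourierCoeff_supportFun_eq_zero hK hw heven hn]
  split_ifs with hlarge
  · ring
  · obtain ⟨hlo, hhi⟩ := abs_lt.1 (not_le.1 hlarge)
    obtain rfl | rfl | rfl | rfl : k = -2 ∨ k = -1 ∨ k = 0 ∨ k = 1 := by omega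
    all_goals push_cast; ring

theorem hasSum_visualBound (hK : IsStrictlyConvexC2 K) (hw : HasConstantWidth K) :
    HasSum (fun n : ℤ => 16 * highEnergy (supportFun K) n) (visualBound K) := by
  have h := (hasSum_integral_angleKernel hK.contDiff (supportFun_periodic K)).mul_left
    (64 / 9 * π)
  rw [visualBound, integral_angleIntegrand_visualAngle hK]
  convert! h using 1
  · funext n
    unfold highEnergy
    by_cases hn : n = 0 ∨ Odd n
    · rw [integral_angleKernel_mul_gapMultiplier hn]
      split_ifs <;> ring
    · rw [not_or, Int.not_odd_iff_even] at hn
      simp [realFourierCoeff_supportFun_eq_zero hK hw hn.2 hn.1]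
  · field_simp

theorem hasSum_widthDeficit_sub_visualBound (hK : IsStrictlyConvexC2 K)
    (hw : HasConstantWidth K) :
    HasSum (fun n : ℤ => ((n : ℝ) ^ 2 - 25) * highEnergy (supportFun K) n)
      (widthDeficit K - visualBound K) :=
  ((hasSum_widthDeficit hK hw).sub (hasSum_visualBound hK hw)).congr_fun fun n => by ring

theorem sq_sub_mul_highEnergy_nonneg (f : ℝ → ℝ) (n : ℤ) :
    0 ≤ ((n : ℝ) ^ 2 - 25) * highEnergy f n := by
  rcases le_or_gt 5 |n| with hn | hn
  · have := sq_le_sq_of_le_abs (by norm_num) hn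
    push_cast at this
    exact mul_nonneg (by linarith) (highEnergy_nonneg f n)
  · simp [highEnergy, hn.not_ge]

theorem visualBound_le_widthDeficit (hK : IsStrictlyConvexC2 K) (hw : HasConstantWidth K) :
    visualBound K ≤ widthDeficit K :=
  sub_nonneg.1 ((hasSum_widthDeficit_sub_visualBound hK hw).nonneg
    (sq_sub_mul_highEnergy_nonneg _))

theorem visualBound_nonneg (hK : IsStrictlyConvexC2 K) (hw : HasConstantWidth K) :
    0 ≤ visualBound K :=
  (hasSum_visualBound hK hw).nonneg fun n => mul_nonneg (by norm_num) (highEnergy_nonneg _ n)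

theorem widthDeficit_eq_zero_of_visualBound_eq_zero (hK : IsStrictlyConvexC2 K)
    (hw : HasConstantWidth K) (h : visualBound K = 0) : widthDeficit K = 0 := by
  have hsum := hasSum_visualBound hK hw
  rw [h, hasSum_zero_iff_of_nonneg
    fun n => mul_nonneg (by norm_num) (highEnergy_nonneg _ n)] at hsum
  refine (hasSum_widthDeficit hK hw).unique (hasSum_zero.congr_fun fun n => ?_)
  have hn : highEnergy (supportFun K) n = 0 := by simpa using congrFun hsum n
  simp [hn]

theorem widthDeficit_eq_visualBound_iff (hK : IsStrictlyConvexC2 K) (hw : HasConstantWidth K) :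
    widthDeficit K = visualBound K ↔ ∀ n : ℤ, 5 < |n| → realFourierCoeff (supportFun K) n = 0 := by
  have hsum := hasSum_widthDeficit_sub_visualBound hK hw
  rw [← sub_eq_zero]
  constructor
  · intro h n hn
    rw [h, hasSum_zero_iff_of_nonneg (sq_sub_mul_highEnergy_nonneg _)] at hsum
    have hsq := sq_le_sq_of_le_abs (by norm_num : (0 : ℤ) ≤ 6) (by omega : 6 ≤ |n|)
    have hne : (n : ℝ) ^ 2 - 25 ≠ 0 := by push_cast at hsq; linarith
    exact highEnergy_eq_zero_iff.1 ((mul_eq_zero.1 (congrFun hsum n)).resolve_left hne) hn.le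
  · intro h
    refine hsum.unique (hasSum_zero.congr_fun fun n => ?_)
    rcases eq_or_ne |n| 5 with hn | hn
    · have hsq : (n : ℝ) ^ 2 = 25 := by
        exact_mod_cast (by rw [← sq_abs, hn]; norm_num : n ^ 2 = 25)
      rw [hsq, sub_self, zero_mul]
    · rw [highEnergy_eq_zero_iff.2 fun hle => h n (lt_of_le_of_ne hle hn.symm), mul_zero]

/-! ### Trigonometric polynomials -/

section Trigonometric

theorem eq_sum_realFourierCoeff (hf : Continuous f) (hper : Function.Periodic f (2 * π))
    {s : Finset ℤ} (hs : ∀ n ∉ s, realFourierCoeff f n = 0) (x : ℝ) :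
    (f x : ℂ) = ∑ n ∈ s, realFourierCoeff f n * Complex.exp (n * x * Complex.I) := by
  have : Fact (0 < 2 * π) := ⟨two_pi_pos⟩
  have hpi : (π : ℂ) ≠ 0 := by exact_mod_cast pi_ne_zero
  have hp : Function.Periodic (fun x => (f x : ℂ)) (2 * π) := fun x => by simp only [hper x]
  let g : C(AddCircle (2 * π), ℂ) :=
    ⟨hp.lift, (by fun_prop : Continuous fun x => (f x : ℂ)).quotient_liftOn' _⟩
  have hg (y : ℝ) : g (y : AddCircle (2 * π)) = f y := hp.lift_coe y
  have hcoeff (n : ℤ) : fourierCoeff g n = realFourierCoeff f n := by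
    rw [fourierCoeff_eq_intervalIntegral g n 0, realFourierCoeff, fourierCoeffOn_eq_integral,
      zero_add]
    simp only [hg, fourier_coe_apply, sub_zero]
  have hfinite : HasSum (fun n => fourierCoeff g n • fourier n (x : AddCircle (2 * π)))
      (∑ n ∈ s, fourierCoeff g n • fourier n (x : AddCircle (2 * π))) :=
    hasSum_sum_of_ne_finset_zero fun n hn => by rw [hcoeff, hs n hn, zero_smul]
  have hsummable : Summable (fourierCoeff g) :=
    summable_of_ne_finset_zero (s := s) fun n hn => by rw [hcoeff, hs n hn]
  rw [← hg, (has_pointwise_sum_fourier_series_of_summable hsummable x).unique hfinite]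
  refine Finset.sum_congr rfl fun n _ => ?_
  rw [hcoeff, smul_eq_mul, fourier_coe_apply]
  congr 2
  push_cast
  field_simp

/-- The harmonic of order `n` of a real function `f`, encoded as the vector `v` for which the terms
of order `±n` of the Fourier series of `f` add up to `⟨v, N(nφ)⟩`. -/
def harmonicVector (f : ℝ → ℝ) (n : ℤ) : Plane :=
  !₂[(realFourierCoeff f n).re + (realFourierCoeff f (-n)).re,
    (realFourierCoeff f (-n)).im - (realFourierCoeff f n).im]

theorem re_fourierTerm_add_neg (f : ℝ → ℝ) (n : ℤ) (φ : ℝ) :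
    (realFourierCoeff f n * Complex.exp (n * φ * Complex.I) +
      realFourierCoeff f (-n) * Complex.exp ((-n : ℤ) * φ * Complex.I)).re =
      inner ℝ (harmonicVector f n) (dirN (n * φ)) := by
  have hexp (m : ℤ) : Complex.exp (m * φ * Complex.I) =
      cos (m * φ) + sin (m * φ) * Complex.I := by
    rw [Complex.exp_mul_I]
    push_cast
    rfl
  rw [hexp, hexp, inner_dirN]
  simp [harmonicVector, -Complex.ofReal_cos, -Complex.ofReal_sin, -Complex.ofReal_mul]
  ring

/-- A trigonometric polynomial with frequencies `0`, `1`, `3` and `5`. -/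
def trigSum (a : ℝ) (c u v : Plane) (φ : ℝ) : ℝ :=
  a + inner ℝ c (dirN φ) + inner ℝ u (dirN (3 * φ)) + inner ℝ v (dirN (5 * φ))

theorem eq_trigSum_of_realFourierCoeff_eq_zero (hf : Continuous f)
    (hper : Function.Periodic f (2 * π)) (hhigh : ∀ n : ℤ, 5 < |n| → realFourierCoeff f n = 0)
    (heven : ∀ n : ℤ, Even n → n ≠ 0 → realFourierCoeff f n = 0) :
    f = trigSum (realFourierCoeff f 0).re (harmonicVector f 1) (harmonicVector f 3)
      (harmonicVector f 5) := by
  have hs : ∀ n ∉ ({0, 1, -1, 3, -3, 5, -5} : Finset ℤ), realFourierCoeff f n = 0 := by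
    intro n hn
    simp only [Finset.mem_insert, Finset.mem_singleton, not_or] at hn
    rcases Int.even_or_odd n with he | ho
    · exact heven n he hn.1
    · exact hhigh n (by grind)
  funext φ
  have hpair (n : ℤ) := re_fourierTerm_add_neg f n φ
  have h1 := hpair 1
  have h3 := hpair 3
  have h5 := hpair 5
  have hsum := congrArg Complex.re (eq_sum_realFourierCoeff hf hper hs φ)
  simp only [Complex.ofReal_re, Complex.re_sum, Complex.add_re, Int.cast_one, one_mul,
    Int.cast_ofNat] at h1 h3 h5 hsum
  rw [hsum, trigSum, ← h1, ← h3, ← h5]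
  simp [Finset.sum_insert]
  ring

variable (v : Plane)

theorem hasDerivAt_inner_dirN_mul (k x : ℝ) :
    HasDerivAt (fun x => inner ℝ v (dirN (k * x))) (k * inner ℝ v (dirT (k * x))) x := by
  have h := (hasDerivAt_const x v).inner ℝ
    ((hasDerivAt_dirN (k * x)).scomp x (hasDerivAt_const_mul k))
  exact h.congr_deriv (by simp [real_inner_smul_right])

theorem hasDerivAt_inner_dirT_mul (k x : ℝ) :
    HasDerivAt (fun x => inner ℝ v (dirT (k * x))) (-k * inner ℝ v (dirN (k * x))) x := by
  have h := (hasDerivAt_const x v).inner ℝ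
    ((hasDerivAt_dirT (k * x)).scomp x (hasDerivAt_const_mul k))
  exact h.congr_deriv (by simp [real_inner_smul_right])

theorem inner_dirN_mul_periodic (k : ℕ) :
    Function.Periodic (fun x => inner ℝ v (dirN (k * x))) (2 * π) := fun x => by
  simp only [mul_add, dirN_periodic.nat_mul k (k * x)]

theorem inner_dirT_mul_periodic (k : ℕ) :
    Function.Periodic (fun x => inner ℝ v (dirT (k * x))) (2 * π) := fun x => by
  simp only [mul_add, dirT_periodic.nat_mul k (k * x)]

theorem contDiff_inner_dirN_mul (k : ℝ) {n : WithTop ℕ∞} :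
    ContDiff ℝ n fun x => inner ℝ v (dirN (k * x)) :=
  contDiff_const.inner ℝ (contDiff_dirN.comp (contDiff_const.mul contDiff_id))

theorem realFourierCoeff_inner_dirN_mul (k : ℕ) {n : ℤ} (hn : (n : ℝ) ^ 2 ≠ (k : ℝ) ^ 2) :
    realFourierCoeff (fun x => inner ℝ v (dirN (k * x))) n = 0 :=
  realFourierCoeff_eq_zero_of_deriv_deriv (hasDerivAt_inner_dirN_mul v k)
    (fun x => ((hasDerivAt_inner_dirT_mul v k x).const_mul (k : ℝ)).congr_deriv (by ring))
    (inner_dirN_mul_periodic v k)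
    (fun x => congrArg ((k : ℝ) * ·) (inner_dirT_mul_periodic v k x)) hn

theorem realFourierCoeff_trigSum (a : ℝ) (c u v : Plane) {n : ℤ} (hn : 5 < |n|) :
    realFourierCoeff (trigSum a c u v) n = 0 := by
  have hsq := sq_le_sq_of_le_abs (by norm_num : (0 : ℤ) ≤ 6) (by omega : 6 ≤ |n|)
  have hn0 : n ≠ 0 := by
    rintro rfl
    simp at hn
  have hcoeff (w : Plane) (k : ℕ) (hk : k ≤ 5) :
      realFourierCoeff (fun x => inner ℝ w (dirN (k * x))) n = 0 := by
    have hk' : (k : ℝ) ≤ 5 := by exact_mod_cast hk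
    refine realFourierCoeff_inner_dirN_mul w k fun h => ?_
    push_cast at hsq
    nlinarith [k.cast_nonneg (α := ℝ)]
  have hcont (w : Plane) (k : ℝ) : Continuous fun x => inner ℝ w (dirN (k * x)) :=
    (contDiff_inner_dirN_mul w k (n := 0)).continuous
  have c1 := hcont c 1
  have c3 := hcont u 3
  have h1 := hcoeff c 1 (by norm_num)
  have h3 := hcoeff u 3 (by norm_num)
  have h5 := hcoeff v 5 le_rfl
  simp only [one_mul, Nat.cast_one, Nat.cast_ofNat] at h1 h3 h5 c1
  unfold trigSum
  rw [realFourierCoeff_add (by fun_prop) (hcont v 5), realFourierCoeff_add (by fun_prop) c3,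
    realFourierCoeff_add (by fun_prop) c1, realFourierCoeff_const a hn0, h1, h3, h5]
  simp

end Trigonometric

/-! ### Hypocycloids -/

section Hypocycloid

variable {r k α : ℝ} {c : Plane}

theorem inner_rotate_dirN (α s : ℝ) (v : Plane) :
    inner ℝ (rotate α v) (dirN (α + s)) = inner ℝ v (dirN s) := by
  simp only [inner_dirN, rotate, cos_add, sin_add, Matrix.cons_val_zero,
    Matrix.cons_val_one]
  linear_combination (v 0 * cos s + v 1 * sin s) * sin_sq_add_cos_sq α

theorem inner_rotate_dirT (α s : ℝ) (v : Plane) :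
    inner ℝ (rotate α v) (dirT (α + s)) = inner ℝ v (dirT s) := by
  simp only [inner_dirT, rotate, cos_add, sin_add, Matrix.cons_val_zero,
    Matrix.cons_val_one]
  linear_combination (v 1 * cos s - v 0 * sin s) * sin_sq_add_cos_sq α

theorem inner_hypocycloid_dirN (r k t : ℝ) :
    inner ℝ (hypocycloid r k t) (dirN ((k - 2) / 2 * t)) = r * (k - 2) * sin (k / 2 * t) := by
  have hadd := sin_add t ((k - 2) / 2 * t)
  have hsub := sin_sub ((k - 1) * t) ((k - 2) / 2 * t)
  rw [show t + (k - 2) / 2 * t = k / 2 * t by ring] at hadd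
  rw [show (k - 1) * t - (k - 2) / 2 * t = k / 2 * t by ring] at hsub
  simp only [inner_dirN, hypocycloid, Matrix.cons_val_zero, Matrix.cons_val_one]
  linear_combination -r * (k - 1) * hadd + r * hsub

theorem inner_hypocycloid_dirT (r k t : ℝ) :
    inner ℝ (hypocycloid r k t) (dirT ((k - 2) / 2 * t)) = r * k * cos (k / 2 * t) := by
  have hadd := cos_add t ((k - 2) / 2 * t)
  have hsub := cos_sub ((k - 1) * t) ((k - 2) / 2 * t)
  rw [show t + (k - 2) / 2 * t = k / 2 * t by ring] at hadd
  rw [show (k - 1) * t - (k - 2) / 2 * t = k / 2 * t by ring] at hsub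
  simp only [inner_dirT, hypocycloid, Matrix.cons_val_zero, Matrix.cons_val_one]
  linear_combination -r * (k - 1) * hadd - r * hsub

theorem mul_sin_mul_sub_eq_inner (s m α φ : ℝ) :
    s * sin (m * (φ - α)) = inner ℝ (s • dirT (m * α)) (dirN (m * φ)) := by
  rw [real_inner_smul_left, inner_dirT_dirN, mul_sub]

theorem hasDerivAt_inner_add_mul_sin (s m α φ : ℝ) :
    HasDerivAt (fun φ => inner ℝ c (dirN φ) + s * sin (m * (φ - α)))
      (inner ℝ c (dirT φ) + s * m * cos (m * (φ - α))) φ := by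
  have hN := hasDerivAt_inner_dirN_mul c 1 φ
  simp only [one_mul] at hN
  have hsin := (((hasDerivAt_id φ).sub_const α).const_mul m).sin.const_mul s
  exact (hN.add hsin).congr_deriv (by simp only [id_eq, mul_one]; ring)

theorem envelope_eq_hypocycloid_iff (hk : k ≠ 2) :
    (∀ t, envelope f (α + (k - 2) / 2 * t) = c + rotate α (hypocycloid r k t)) ↔
      ∀ φ, f φ = inner ℝ c (dirN φ) + r * (k - 2) * sin (k / (k - 2) * (φ - α)) := by
  have hk2 : k - 2 ≠ 0 := sub_ne_zero.2 hk
  have hangle (t : ℝ) : k / (k - 2) * (α + (k - 2) / 2 * t - α) = k / 2 * t := by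
    field_simp
    ring
  have hN (t : ℝ) : inner ℝ (c + rotate α (hypocycloid r k t)) (dirN (α + (k - 2) / 2 * t)) =
      inner ℝ c (dirN (α + (k - 2) / 2 * t)) + r * (k - 2) * sin (k / 2 * t) := by
    rw [inner_add_left, inner_rotate_dirN, inner_hypocycloid_dirN]
  constructor
  · intro h φ
    obtain ⟨t, rfl⟩ : ∃ t, φ = α + (k - 2) / 2 * t :=
      ⟨2 * (φ - α) / (k - 2), by field_simp; ring⟩
    rw [hangle, ← hN, ← h, inner_envelope_dirN]
  · intro h t
    refine eq_of_inner_dirN_of_inner_dirT (α + (k - 2) / 2 * t) ?_ ?_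
    · rw [inner_envelope_dirN, h, hangle, hN]
    · rw [inner_envelope_dirT, funext h, (hasDerivAt_inner_add_mul_sin _ _ _ _).deriv, hangle,
        inner_add_left, inner_rotate_dirT, inner_hypocycloid_dirT]
      field_simp

theorem sin_eq_zero_of_periodic_of_envelope_eq_hypocycloid (hk : k ≠ 2) (hr : r ≠ 0)
    (hper : Function.Periodic f (2 * π))
    (h : ∀ t, envelope f (α + (k - 2) / 2 * t) = c + rotate α (hypocycloid r k t)) :
    sin (k / (k - 2) * (2 * π)) = 0 := by
  rw [envelope_eq_hypocycloid_iff hk] at h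
  have hturn := hper α
  rw [h, h, dirN_periodic] at hturn
  simpa [hr, sub_ne_zero.2 hk] using hturn

theorem exists_eq_of_isHypocycloidSupport_three (h : IsHypocycloidSupport 3 f) :
    ∃ c u : Plane, ∀ φ, f φ = inner ℝ c (dirN φ) + inner ℝ u (dirN (3 * φ)) := by
  obtain ⟨-, -, n, hn, -, hn2, r, α, c, -, h⟩ := h
  obtain rfl : n = 1 := by omega
  rw [envelope_eq_hypocycloid_iff (by norm_num)] at h
  simp only [mul_sin_mul_sub_eq_inner] at h
  exact ⟨c, _, fun φ => by convert! h φ using 4; norm_num⟩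

theorem exists_eq_of_isHypocycloidSupport_five (h : IsHypocycloidSupport 5 f) :
    ∃ c u : Plane, ∀ φ, f φ = inner ℝ c (dirN φ) + inner ℝ u (dirN (5 * φ)) := by
  obtain ⟨-, hper, n, hn, -, hn2, r, α, c, hr, h⟩ := h
  obtain rfl | rfl : n = 1 ∨ n = 2 := by omega
  · have hzero := sin_eq_zero_of_periodic_of_envelope_eq_hypocycloid (by norm_num) hr.ne' hper h
    have hpos : 0 < sin (π / 3) :=
      sin_pos_of_pos_of_lt_pi (by positivity) (by linarith [pi_pos])
    norm_num at hzero
    rw [show 5 / 3 * (2 * π) = π / 3 + π + 2 * π by ring, sin_add_two_pi, sin_add_pi] at hzero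
    linarith
  · rw [envelope_eq_hypocycloid_iff (by norm_num)] at h
    simp only [mul_sin_mul_sub_eq_inner] at h
    exact ⟨c, _, fun φ => by convert! h φ using 4; norm_num⟩

theorem exists_eq_norm_smul_dirT_mul (u : Plane) {m : ℝ} (hm : m ≠ 0) :
    ∃ α, u = ‖u‖ • dirT (m * α) := by
  obtain ⟨θ, hθ⟩ := exists_eq_norm_smul_dirN u
  have hrot : dirT (θ - π / 2) = dirN θ :=
    plane_ext (by simp [sin_sub_pi_div_two]) (by simp [cos_sub_pi_div_two])
  exact ⟨(θ - π / 2) / m, by rwa [mul_div_cancel₀ _ hm, hrot]⟩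

theorem isHypocycloidSupport_of_eq {n : ℕ} (hn : 0 < n) {u : Plane} (hu : u ≠ 0)
    (h : ∀ φ, f φ = inner ℝ c (dirN φ) + inner ℝ u (dirN ((2 * n + 1 : ℕ) * φ))) :
    IsHypocycloidSupport (2 * n + 1) f := by
  have hn0 : (n : ℝ) ≠ 0 := by positivity
  have hratio : ((2 * n + 1 : ℕ) : ℝ) / n - 2 = 1 / n := by
    push_cast
    field_simp
    ring
  refine ⟨?_, fun φ => ?_, n, hn, by simp [Nat.coprime_comm], by omega, ?_⟩
  · rw [funext h]
    exact (contDiff_const.inner ℝ contDiff_dirN).add (contDiff_inner_dirN_mul u _)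
  · have hharmonic := inner_dirN_mul_periodic u (2 * n + 1) φ
    beta_reduce at hharmonic
    rw [h, h, dirN_periodic, hharmonic]
  · obtain ⟨α, hα⟩ := exists_eq_norm_smul_dirT_mul u (m := (2 * n + 1 : ℕ)) (by positivity)
    refine ⟨n * ‖u‖, α, c, mul_pos (by positivity) (norm_pos_iff.2 hu),
      (envelope_eq_hypocycloid_iff (sub_ne_zero.1 (by rw [hratio]; positivity))).2 fun φ => ?_⟩
    have hradius : n * ‖u‖ * (1 / n) = ‖u‖ := by field_simp
    have hfreq : ((2 * n + 1 : ℕ) : ℝ) / n / (1 / n) = (2 * n + 1 : ℕ) := by field_simp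
    rw [h, hratio, hradius, hfreq, mul_sin_mul_sub_eq_inner, ← hα]

end Hypocycloid

/-! ### The equality case -/

section Equality

variable {a : ℝ} {c u v : Plane}

/-- The functions that occur as support functions in the equality case: trigonometric polynomials
with frequencies `0`, `1`, `3` and `5`. -/
def IsTrigSum (f : ℝ → ℝ) : Prop := ∃ (a : ℝ) (c u v : Plane), f = trigSum a c u v

theorem IsTrigSum.sum {ι : Type*} [Fintype ι] {f : ι → ℝ → ℝ} (hf : ∀ i, IsTrigSum (f i)) :
    IsTrigSum fun φ => ∑ i, f i φ := by
  choose a c u v hf using hf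
  refine ⟨∑ i, a i, ∑ i, c i, ∑ i, u i, ∑ i, v i, funext fun φ => ?_⟩
  simp only [hf, trigSum, sum_inner, Finset.sum_add_distrib]

theorem isTrigSum_of_isParallelToHypocycloid_three (h : IsParallelToHypocycloid 3 f) :
    IsTrigSum f := by
  obtain ⟨g, hg, d, h⟩ := h
  obtain ⟨c, u, hg⟩ := exists_eq_of_isHypocycloidSupport_three hg
  refine ⟨d, c, u, 0, funext fun φ => ?_⟩
  rw [h, hg, trigSum, inner_zero_left]
  ring

theorem isTrigSum_of_isParallelToHypocycloid_five (h : IsParallelToHypocycloid 5 f) :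
    IsTrigSum f := by
  obtain ⟨g, hg, d, h⟩ := h
  obtain ⟨c, v, hg⟩ := exists_eq_of_isHypocycloidSupport_five hg
  refine ⟨d, c, 0, v, funext fun φ => ?_⟩
  rw [h, hg, trigSum, inner_zero_left]
  ring

theorem supportFun_closedBall_eq_trigSum (c : Plane) {R : ℝ} (hR : 0 ≤ R) :
    supportFun (Metric.closedBall c R) = trigSum R c 0 0 := by
  funext φ
  rw [supportFun_closedBall c hR, trigSum, inner_zero_left, inner_zero_left]
  ring

theorem isTrigSum_supportFun_closedBall (c : Plane) {R : ℝ} (hR : 0 ≤ R) :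
    IsTrigSum (supportFun (Metric.closedBall c R)) :=
  ⟨R, c, 0, 0, supportFun_closedBall_eq_trigSum c hR⟩

theorem IsSummand.isTrigSum (h : IsSummand f) : IsTrigSum f := by
  rcases h with ⟨c, R, hR, rfl⟩ | h | h
  · exact isTrigSum_supportFun_closedBall c hR.le
  · exact isTrigSum_of_isParallelToHypocycloid_three h
  · exact isTrigSum_of_isParallelToHypocycloid_five h

theorem IsMinkowskiSum.isTrigSum (h : IsMinkowskiSum K) : IsTrigSum (supportFun K) := by
  obtain ⟨n, f, hf, h⟩ := h
  rw [funext h]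
  exact IsTrigSum.sum fun i => (hf i).isTrigSum

theorem isParallelToHypocycloid_three (hu : u ≠ 0) :
    IsParallelToHypocycloid 3 (trigSum a c u 0) := by
  refine ⟨fun φ => inner ℝ c (dirN φ) + inner ℝ u (dirN (3 * φ)),
    isHypocycloidSupport_of_eq (n := 1) (c := c) one_pos hu fun φ => by norm_num, a, fun φ => ?_⟩
  rw [trigSum, inner_zero_left]
  ring

theorem isParallelToHypocycloid_five (hv : v ≠ 0) :
    IsParallelToHypocycloid 5 (trigSum a c 0 v) := by
  refine ⟨fun φ => inner ℝ c (dirN φ) + inner ℝ v (dirN (5 * φ)),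
    isHypocycloidSupport_of_eq (n := 2) (c := c) two_pos hv fun φ => by norm_num, a, fun φ => ?_⟩
  rw [trigSum, inner_zero_left]
  ring

theorem isMinkowskiSum_of_supportFun_eq_trigSum (hu : u ≠ 0) (hv : v ≠ 0)
    (h : supportFun K = trigSum a c u v) : IsMinkowskiSum K := by
  refine ⟨1, ![trigSum a c u 0, trigSum 0 0 0 v], Fin.forall_fin_two.2 ⟨?_, ?_⟩, fun φ => ?_⟩
  · exact Or.inr (Or.inl (isParallelToHypocycloid_three hu))
  · exact Or.inr (Or.inr (isParallelToHypocycloid_five hv))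
  · simp [h, Fin.sum_univ_two, trigSum]

theorem pos_of_supportFun_eq_trigSum (hK : IsStrictlyConvexC2 K)
    (h : supportFun K = trigSum a c 0 0) : 0 < a := by
  have hgap := supportGap_pos hK.contDiff hK.radius_pos 0 pi_ne_zero (abs_of_pos pi_pos).le
  simp only [supportGap, h, trigSum, inner_zero_left, inner_dirN_add, cos_pi, sin_pi] at hgap
  linarith

theorem eq_closedBall_of_supportFun_eq_trigSum (hK : IsStrictlyConvexC2 K)
    (h : supportFun K = trigSum a c 0 0) : K = Metric.closedBall c a := by
  have ha := (pos_of_supportFun_eq_trigSum hK h).le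
  exact eq_of_supportFun_eq hK.nonempty hK.isCompact hK.convex
    (Metric.nonempty_closedBall.2 ha) (isCompact_closedBall c a) (convex_closedBall c a)
    (h.trans (supportFun_closedBall_eq_trigSum c ha).symm)

theorem isTrigSum_supportFun_iff (hK : IsStrictlyConvexC2 K) :
    IsTrigSum (supportFun K) ↔
      (∃ (c : Plane) (R : ℝ), 0 < R ∧ K = Metric.closedBall c R) ∨
        IsParallelToHypocycloid 3 (supportFun K) ∨ IsParallelToHypocycloid 5 (supportFun K) ∨
        IsMinkowskiSum K := by
  constructor
  · rintro ⟨a, c, u, v, h⟩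
    rcases eq_or_ne u 0 with rfl | hu <;> rcases eq_or_ne v 0 with rfl | hv
    · exact Or.inl ⟨c, a, pos_of_supportFun_eq_trigSum hK h,
        eq_closedBall_of_supportFun_eq_trigSum hK h⟩
    · exact Or.inr (Or.inr (Or.inl (h ▸ isParallelToHypocycloid_five hv)))
    · exact Or.inr (Or.inl (h ▸ isParallelToHypocycloid_three hu))
    · exact Or.inr (Or.inr (Or.inr (isMinkowskiSum_of_supportFun_eq_trigSum hu hv h)))
  · rintro (⟨c, R, hR, rfl⟩ | h | h | h)
    · exact isTrigSum_supportFun_closedBall c hR.le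
    · exact isTrigSum_of_isParallelToHypocycloid_three h
    · exact isTrigSum_of_isParallelToHypocycloid_five h
    · exact h.isTrigSum

theorem widthDeficit_eq_visualBound_iff_isTrigSum (hK : IsStrictlyConvexC2 K)
    (hw : HasConstantWidth K) :
    widthDeficit K = visualBound K ↔ IsTrigSum (supportFun K) := by
  rw [widthDeficit_eq_visualBound_iff hK hw]
  constructor
  · intro hhigh
    exact ⟨_, _, _, _, eq_trigSum_of_realFourierCoeff_eq_zero hK.contDiff.continuous
      (supportFun_periodic K) hhigh fun n hn => realFourierCoeff_supportFun_eq_zero hK hw hn⟩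
  · rintro ⟨a, c, u, v, h⟩ n hn
    rw [h, realFourierCoeff_trigSum a c u v hn]

end Equality

end HurwitzWidth

end

theorem mainTheorem4 (K : Set HurwitzWidth.Plane)
    (hK : HurwitzWidth.IsStrictlyConvexC2 K) (hw : HurwitzWidth.HasConstantWidth K) :
    MeasureTheory.IntegrableOn
        (fun P => HurwitzWidth.angleIntegrand (HurwitzWidth.visualAngle K P)) Kᶜ ∧
      HurwitzWidth.widthDeficit K ≥ HurwitzWidth.visualBound K ∧
      (HurwitzWidth.widthDeficit K ≠ 0 → 0 < HurwitzWidth.visualBound K) ∧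
      (HurwitzWidth.widthDeficit K = 0 → HurwitzWidth.visualBound K = 0) ∧
      (HurwitzWidth.widthDeficit K = HurwitzWidth.visualBound K ↔
        (∃ (c : HurwitzWidth.Plane) (R : ℝ), 0 < R ∧ K = Metric.closedBall c R) ∨
        HurwitzWidth.IsParallelToHypocycloid 3 (HurwitzWidth.supportFun K) ∨
        HurwitzWidth.IsParallelToHypocycloid 5 (HurwitzWidth.supportFun K) ∨
        HurwitzWidth.IsMinkowskiSum K) := by
  have hle := HurwitzWidth.visualBound_le_widthDeficit hK hw
  have hnn := HurwitzWidth.visualBound_nonneg hK hw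
  refine ⟨HurwitzWidth.integrableOn_angleIntegrand_visualAngle hK, hle,
    fun h => hnn.lt_of_ne' fun h0 => h ?_, fun h => le_antisymm (h ▸ hle) hnn, ?_⟩
  · exact HurwitzWidth.widthDeficit_eq_zero_of_visualBound_eq_zero hK hw h0
  · rw [HurwitzWidth.widthDeficit_eq_visualBound_iff_isTrigSum hK hw,
      HurwitzWidth.isTrigSum_supportFun_iff hK]
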